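/- Let $k,a>0$. In $L^2(\mathbb R^2;\mathbb C)$ put, for $\mathbf s=(s_1,s_2,s_3)\in\mathbb R^3$ and $\mathbf r=(x_1,x_2)$, $r=|\mathbf r|$, $$\Phi_{\mathbf s}(\mathbf r)=\frac{1}{\sqrt{\pi}\,a}\,\mathrm{circ}(r/a)\,\exp\!\big[ik\big(s_1x_1+s_2x_2-s_3r^2/2\big)\big],$$ where $\mathrm{circ}(r/a)=1$ for $r\le a$ and $0$ otherwise, and let $\rho_{\mathbf s}=\tfrac12|\Phi_{\mathbf s}\rangle\langle\Phi_{\mathbf s}|+\tfrac12|\Phi_{-\mathbf s}\rangle\langle\Phi_{-\mathbf s}|$ be the one-photon state of two incoherent point sources at $\pm\mathbf s$. Let $L_{i\mathbf s}$ be symmetric logarithmic derivatives, i.e. bounded self-adjoint operators with $\tfrac12(L_{i\mathbf s}\rho_{\mathbf s}+\rho_{\mathbf s}L_{i\mathbf s})=\partial_i\rho_{\mathbf s}$ (they exist; any choice is allowed). For a projector $\Pi$ set $$\mathcal F_{ij}(\mathbf s)=\frac{\partial_i\mathrm{Tr}(\rho_{\mathbf s}\Pi)\,\partial_j\mathrm{Tr}(\rho_{\mathbf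 s}\Pi)}{\mathrm{Tr}(\rho_{\mathbf s}\Pi)},\qquad \mathcal I_{ij}(\mathbf s)=\mathrm{Re}\,\mathrm{Tr}(\rho_{\mathbf s}L_{i\mathbf s}\Pi L_{j\mathbf s}).$$ Call $\Pi$ regular if $\mathrm{Tr}(\rho_0\Pi)\ne0$ and null if $\mathrm{Tr}(\rho_0\Pi)=0$. A regular $\Pi$ is said to saturate its matrix bound in the limit $\mathbf s\to0$ (to be locally optimal) if $\mathcal F(\mathbf s)$ and $\mathcal I(\mathbf s)$ have the same limit as $\mathbf s\to0$. For a null $\Pi$, where $\mathcal F$ is of the form $0/0$ at $\mathbf s=0$ and is evaluated through the second-order terms of numerator and denominator, it means that $\mathcal I(\mathbf s)$ has a limit $J$ as $\mathbf s\to0$ and that $\mathcal F(t\delta')\to J$ as $t\downarrow0$, $\delta'\to\delta$, for every direction $\delta$ along which $\mathrm{Tr}(\rho_{t\delta}\Pi)$ is not $o(t^2)$ (for every $\delta$, if $J=0$). Let $(\pi_\alpha)$ be an orthonormal family and $\Pi=\sum_\alpha|\pi_\alpha\rangle\langle\pi_\alpha|$. All derivatives $\partial_i\Phi_{\mathbf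 s}$ below are taken at $\mathbf s=0$, and $|\partial_i^0\Phi_{\mathbf s}\rangle=|\partial_i\Phi_{\mathbf s}\rangle-|\Phi_0\rangle\langle\Phi_0|\partial_i\Phi_{\mathbf s}\rangle$. (1) If $\Pi$ is regular, it saturates its matrix bound in the limit $\mathbf s\to0$ if and only if $\langle\partial_i^0\Phi_{\mathbf s}|\pi_\alpha\rangle=0$ for all $i,\alpha$. (2) If $\Pi$ is null, it saturates its matrix bound in the limit $\mathbf s\to0$ if and only if for every pair $i,j$ there is a real $\eta_{ij}$, independent of $\alpha$, with $\langle\partial_i\Phi_{\mathbf s}|\pi_\alpha\rangle=\eta_{ij}\langle\partial_j\Phi_{\mathbf s}|\pi_\alpha\rangle$ for all $\alpha$, or a real $\eta_{ji}$, independent of $\alpha$, with $\langle\partial_j\Phi_{\mathbf s}|\pi_\alpha\rangle=\eta_{ji}\langle\partial_i\Phi_{\mathbf s}|\pi_\alpha\rangle$ for all $\alpha$. (3) Let $Z_n^m$ be the normalized Zernike functions on the disc $r\le a$, extended by zero. They are orthonormal, and $Z_0^0=\Phi_0$. Each $Z_n^m$ with $(n,m)\ne(0,0),(1,\pm1),(2,0)$,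 and each function vanishing on the disc, is flexible, i.e. orthogonal to $\Phi_0$ and to all $\partial_i\Phi_{\mathbf s}$. Let $\Pi_1$ be the projector onto the closed span of $Z_0^0$ and all these flexible modes, and $\Pi_2,\Pi_3,\Pi_4$ the projectors onto $Z_1^1$, $Z_1^{-1}$, $Z_2^0$. Then $\Pi_1,\dots,\Pi_4$ are mutually orthogonal with sum $1$, $\Pi_1$ is regular, $\Pi_2,\Pi_3,\Pi_4$ are null, and each of them saturates its matrix bound in the limit $\mathbf s\to0$. The measurement is optimal in this limit: the quantum Fisher information matrix $\mathrm{Re}\,\mathrm{Tr}(\rho_{\mathbf s}L_{i\mathbf s}L_{j\mathbf s})$ tends to $\mathrm{diag}(k^2a^2,k^2a^2,k^2a^4/12)$ as $\mathbf s\to0$, and so does the total classical Fisher information matrix $\sum_{k'=1}^{4}\mathcal F^{k'}(t\delta')$ as $t\downarrow0$, $\delta'\to\delta$, for every $\delta$ with $\delta_1\delta_2\delta_3\neq0$. -/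

import Mathlib

open Filter Topology MeasureTheory

noncomputable section

namespace TwoSources

/-! ### The pupil plane and the one-photon state -/

/-- The pupil plane, with coordinates `r = (x₁, x₂)`. -/
abbrev Plane := EuclideanSpace ℝ (Fin 2)

/-- The parameter space of separations `s = (s₁, s₂, s₃)`. -/
abbrev Separation := EuclideanSpace ℝ (Fin 3)

/-- The one-photon Hilbert space `L²(ℝ²; ℂ)`. -/
abbrev Hilb := Lp ℂ 2 (volume : Measure Plane)

/-- Bounded operators on the one-photon Hilbert space. -/
abbrev Op := Hilb →L[ℂ] Hilb

/-- The `i`-th coordinate direction of the parameter space. -/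
abbrev dir (i : Fin 3) : Separation := EuclideanSpace.single i (1 : ℝ)

/-- A bounded measurable function, cut off to a disc, is square integrable. -/
theorem memLp_disc (a : ℝ) {f : Plane → ℂ} (hf : Measurable f) (C : ℝ)
    (hC : ∀ x ∈ Metric.closedBall (0 : Plane) a, ‖f x‖ ≤ C) :
    MemLp ((Metric.closedBall (0 : Plane) a).indicator f) 2 volume := by
  have hs : MeasurableSet (Metric.closedBall (0 : Plane) a) := measurableSet_closedBall
  rw [memLp_indicator_iff_restrict hs]
  have : IsFiniteMeasure ((volume : Measure Plane).restrict (Metric.closedBall 0 a)) :=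
    ⟨by
      rw [Measure.restrict_apply_univ]
      exact measure_closedBall_lt_top⟩
  exact MemLp.of_bound hf.aestronglyMeasurable C
    ((ae_restrict_iff' hs).2 (Eventually.of_forall hC))

/-- The factor `𝒜 exp[i k (s_⊥ · r - s₃ r² / 2)]` of the pupil function, `𝒜 = 1 / (√π a)`. -/
def pupilPhase (k a : ℝ) (s : Separation) (x : Plane) : ℂ :=
  ((1 / (Real.sqrt Real.pi * a) : ℝ) : ℂ) *
    Complex.exp (Complex.I * ((k * (s 0 * x 0 + s 1 * x 1 - s 2 * ‖x‖ ^ 2 / 2) : ℝ) : ℂ))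

/-- The pupil function `Φ_s(r) = 𝒜 circ(r/a) exp[i k (s_⊥ · r - s₃ r² / 2)]`. -/
def pupilFun (k a : ℝ) (s : Separation) : Plane → ℂ :=
  (Metric.closedBall (0 : Plane) a).indicator (pupilPhase k a s)

theorem memLp_pupilFun (k a : ℝ) (s : Separation) : MemLp (pupilFun k a s) 2 volume := by
  refine memLp_disc a ?_ |1 / (Real.sqrt Real.pi * a)| ?_
  · apply Continuous.measurable
    unfold pupilPhase
    fun_prop
  · intro x _
    rw [pupilPhase, norm_mul, mul_comm Complex.I, Complex.norm_exp_ofReal_mul_I,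
      Complex.norm_real, Real.norm_eq_abs, mul_one]

/-- The state `|Φ_s⟩` of a photon emitted by a source at `s`. -/
def pupil (k a : ℝ) (s : Separation) : Hilb := (memLp_pupilFun k a s).toLp _

/-- The one-photon state `ρ_s = ½ |Φ_{+s}⟩⟨Φ_{+s}| + ½ |Φ_{-s}⟩⟨Φ_{-s}|` of two incoherent sources
at `±s` (global phases of the two vectors drop out). -/
def rho (k a : ℝ) (s : Separation) : Op :=
  (1 / 2 : ℂ) • InnerProductSpace.rankOne ℂ (pupil k a s) (pupil k a s) +
    (1 / 2 : ℂ) • InnerProductSpace.rankOne ℂ (pupil k a (-s)) (pupil k a (-s))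

/-- `|∂ᵢ Φ_s⟩` at `s = 0`, the derivative being taken in `L²`. -/
def dPupil (k a : ℝ) (i : Fin 3) : Hilb := lineDeriv ℝ (pupil k a) 0 (dir i)

/-- `|∂ᵢ⁰ Φ_s⟩` at `s = 0`: the projection of `|∂ᵢ Φ_s⟩` onto the kernel of
`ρ_0 = |Φ_0⟩⟨Φ_0|`. -/
def dPupilKer (k a : ℝ) (i : Fin 3) : Hilb :=
  dPupil k a i - inner ℂ (pupil k a 0) (dPupil k a i) • pupil k a 0

/-! ### Projectors, trace, Fisher information -/

/-- The orthogonal projector onto the closed linear span of `S`. If `S` is the range of an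
orthonormal family `π`, this is `∑ α, |π α⟩⟨π α|`. -/
def projOn (S : Set Hilb) : Op := (Submodule.span ℂ S).topologicalClosure.starProjection

/-- The trace `∑ₑ ⟨e|T|e⟩` over an orthonormal basis. (All operators whose trace is taken below
have finite rank, so that the sum converges and does not depend on the basis.) -/
def opTrace (T : Op) : ℂ :=
  ∑' e : (exists_hilbertBasis ℂ Hilb).choose, inner ℂ (e : Hilb) (T (e : Hilb))

/-- The probability `Tr(ρ_s Π)`. -/
def prob (k a : ℝ) (P : Op) (s : Separation) : ℝ := (opTrace (rho k a s * P)).re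

/-- The classical Fisher information matrix due to `Π`,
`∂ᵢ Tr(ρ_s Π) ∂ⱼ Tr(ρ_s Π) / Tr(ρ_s Π)`. -/
def cfim (k a : ℝ) (P : Op) (s : Separation) : Matrix (Fin 3) (Fin 3) ℝ :=
  Matrix.of fun i j =>
    lineDeriv ℝ (prob k a P) s (dir i) * lineDeriv ℝ (prob k a P) s (dir j) / prob k a P s

/-- `L` is a symmetric logarithmic derivative at `s` with respect to `sᵢ`:
`(L ρ_s + ρ_s L) / 2 = ∂ᵢ ρ_s`. -/
def IsSLD (k a : ℝ) (s : Separation) (i : Fin 3) (L : Op) : Prop :=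
  IsSelfAdjoint L ∧
    (1 / 2 : ℂ) • (L * rho k a s + rho k a s * L) = lineDeriv ℝ (rho k a) s (dir i)

/-- The quantum Fisher information matrix corresponding to `Π`, `Re Tr(ρ_s Lᵢ Π Lⱼ)`, where
`L s i` is the symmetric logarithmic derivative at `s` with respect to `sᵢ`. For `Π = 1` it is the
quantum Fisher information matrix of `ρ_s`. -/
def qfim (k a : ℝ) (L : Separation → Fin 3 → Op) (P : Op) (s : Separation) : Matrix (Fin 3) (Fin 3) ℝ :=
  Matrix.of fun i j => (opTrace (rho k a s * L s i * P * L s j)).re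

/-- `Π` is regular at `s = 0`. -/
def RegularAtZero (k a : ℝ) (P : Op) : Prop := opTrace (rho k a 0 * P) ≠ 0

/-- `Π` is null at `s = 0`. -/
def NullAtZero (k a : ℝ) (P : Op) : Prop := opTrace (rho k a 0 * P) = 0

/-! ### Saturation of the matrix bound in the limit `s → 0` -/

/-- `s → 0` along the direction `δ`, i.e. `s = t δ'` with `t ↓ 0` and `δ' → δ`. -/
def alongDir (δ : Separation) : Filter Separation :=
  map (fun p : ℝ × Separation => p.1 • p.2) (𝓝[>] (0 : ℝ) ×ˢ 𝓝 δ)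

/-- For a regular `Π`: the classical and the quantum Fisher information matrices due to `Π` have
the same limit as `s → 0`. -/
def SaturatedRegular (k a : ℝ) (L : Separation → Fin 3 → Op) (P : Op) : Prop :=
  ∃ J : Matrix (Fin 3) (Fin 3) ℝ,
    Tendsto (qfim k a L P) (𝓝[≠] 0) (𝓝 J) ∧ Tendsto (cfim k a P) (𝓝[≠] 0) (𝓝 J)

/-- The probability of `Π` does not vanish to second order along `δ`. For a null `Π` this says
that the second-order term `∑ T_pq δ_p δ_q` of the expansion of `Tr(ρ_s Π)` at `s = 0` is nonzero,
so that the quotient `0/0` which defines the classical Fisher information at `s = 0` has a value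
in the direction `δ`. -/
def Nondegenerate (k a : ℝ) (P : Op) (δ : Separation) : Prop :=
  ¬ (fun t : ℝ => prob k a P (t • δ)) =o[𝓝[>] 0] (fun t : ℝ => t ^ 2)

/-- For a null `Π`: the classical Fisher information matrix due to `Π`, evaluated as the limit
along each direction in which the quotient of the second-order terms is defined, is the limit of
the quantum Fisher information matrix corresponding to `Π`. If the latter limit is zero (which is
the case where no direction is nondegenerate), then all directions are required. -/
def SaturatedNull (k a : ℝ) (L : Separation → Fin 3 → Op) (P : Op) : Prop :=
  ∃ J : Matrix (Fin 3) (Fin 3) ℝ,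
    Tendsto (qfim k a L P) (𝓝[≠] 0) (𝓝 J) ∧
      ∀ δ : Separation, (Nondegenerate k a P δ ∨ J = 0) → Tendsto (cfim k a P) (alongDir δ) (𝓝 J)

/-! ### Zernike modes -/

/-- Indices `(n, m)` with `|m| ≤ n` and `n - |m|` even. -/
abbrev ZernikeIndex := {p : ℕ × ℤ // p.2.natAbs ≤ p.1 ∧ Even (p.1 - p.2.natAbs)}

/-- The radial Zernike polynomial `R_n^m` (`m ≤ n`, `n - m` even). -/
def zernikeRadial (n m : ℕ) (t : ℝ) : ℝ :=
  ∑ j ∈ Finset.range ((n - m) / 2 + 1),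
    (-1 : ℝ) ^ j * ((n - j).factorial : ℝ) /
      ((j.factorial : ℝ) * (((n + m) / 2 - j).factorial : ℝ) *
        (((n - m) / 2 - j).factorial : ℝ)) * t ^ (n - 2 * j)

/-- The polar angle of a point of the pupil plane. -/
def polarAngle (x : Plane) : ℝ := Complex.arg ⟨x 0, x 1⟩

/-- The angular factor: `cos (m φ)` for `m ≥ 0`, `sin (|m| φ)` for `m < 0`. -/
def zernikeAngular (m : ℤ) (φ : ℝ) : ℝ :=
  if 0 ≤ m then Real.cos (m * φ) else Real.sin (m.natAbs * φ)

/-- The constant that normalizes `Z_n^m` in `L²` of the disc of radius `a`. -/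
def zernikeNorm (a : ℝ) (n : ℕ) (m : ℤ) : ℝ :=
  Real.sqrt ((if m = 0 then 1 else 2) * (n + 1) / Real.pi) / a

/-- The normalized Zernike function `Z_n^m(r, φ) = N R_n^{|m|}(r/a) cos(mφ)` or
`N R_n^{|m|}(r/a) sin(|m|φ)` on the disc of radius `a`, extended by zero. -/
def zernikeFun (a : ℝ) (p : ZernikeIndex) : Plane → ℂ :=
  (Metric.closedBall (0 : Plane) a).indicator fun x =>
    ((zernikeNorm a p.1.1 p.1.2 * zernikeRadial p.1.1 p.1.2.natAbs (‖x‖ / a) *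
      zernikeAngular p.1.2 (polarAngle x) : ℝ) : ℂ)

theorem memLp_zernikeFun (a : ℝ) (p : ZernikeIndex) : MemLp (zernikeFun a p) 2 volume := by
  have hc : Continuous fun x : Plane =>
      zernikeNorm a p.1.1 p.1.2 * zernikeRadial p.1.1 p.1.2.natAbs (‖x‖ / a) := by
    unfold zernikeRadial
    fun_prop
  obtain ⟨C, hC⟩ := (isCompact_closedBall (0 : Plane) a).exists_bound_of_continuousOn
    hc.continuousOn
  have hang : ∀ φ, |zernikeAngular p.1.2 φ| ≤ 1 := by
    intro φ
    unfold zernikeAngular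
    split_ifs
    · exact Real.abs_cos_le_one _
    · exact Real.abs_sin_le_one _
  refine memLp_disc a ?_ C ?_
  · have h1 : Measurable polarAngle := by
      have h : Continuous fun x : Plane => (x 0 : ℂ) + (x 1 : ℂ) * Complex.I := by fun_prop
      have h' : polarAngle = fun x : Plane => Complex.arg ((x 0 : ℂ) + (x 1 : ℂ) * Complex.I) := by
        funext x
        rw [polarAngle, Complex.mk_eq_add_mul_I]
      rw [h']
      exact Complex.measurable_arg.comp h.measurable
    have h2 : Measurable (zernikeAngular p.1.2) := by
      unfold zernikeAngular
      split_ifs <;> fun_prop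
    exact Complex.measurable_ofReal.comp (hc.measurable.mul (h2.comp h1))
  · intro x hx
    rw [Complex.norm_real, norm_mul]
    calc _ ≤ C * 1 := mul_le_mul (hC x hx) (hang _) (abs_nonneg _)
            ((norm_nonneg _).trans (hC x hx))
      _ = C := mul_one C

/-- The Zernike mode `|Z_n^m⟩`. -/
def zernike (a : ℝ) (p : ZernikeIndex) : Hilb := (memLp_zernikeFun a p).toLp _

/-- The index `(0, 0)`. -/
def z00 : ZernikeIndex := ⟨(0, 0), by decide⟩
/-- The index `(1, 1)`. -/
def z11 : ZernikeIndex := ⟨(1, 1), by decide⟩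
/-- The index `(1, -1)`. -/
def z1m1 : ZernikeIndex := ⟨(1, -1), by decide⟩
/-- The index `(2, 0)`. -/
def z20 : ZernikeIndex := ⟨(2, 0), by decide⟩

/-- The vectors of `L²(ℝ²)` that vanish on the pupil (modes the photon never occupies). -/
def vanishingOnPupil (a : ℝ) : Set Hilb := {f | ∀ᵐ x : Plane, ‖x‖ ≤ a → f x = 0}

/-- A null vector `|π⟩` is flexible if `⟨∂ᵢΦ_s|π⟩ = 0` at `s = 0` for all `i`. -/
def IsFlexible (k a : ℝ) (v : Hilb) : Prop :=
  inner ℂ (pupil k a 0) v = 0 ∧ ∀ i, inner ℂ (dPupil k a i) v = 0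

/-- The four projectors: onto all modes except `Z_1^1`, `Z_1^{-1}`, `Z_2^0`, and onto each of these
three. -/
def measurement (a : ℝ) : Fin 4 → Op :=
  ![projOn ({f | ∃ p, p ≠ z11 ∧ p ≠ z1m1 ∧ p ≠ z20 ∧ f = zernike a p} ∪ vanishingOnPupil a),
    projOn {zernike a z11}, projOn {zernike a z1m1}, projOn {zernike a z20}]

end TwoSources

end

open TwoSources

/-!
Let `θ_s` be the phase of the pupil function. Its real and imaginary parts `c = 𝒜 cos θ_s` and
`d = 𝒜 sin θ_s` on the disc satisfy `Φ_{±s} = c ± i d`, so that `ρ_s = |c⟩⟨c| + |d⟩⟨d|`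
(`rho_eq`). The vectors `c`, `d` and their derivatives are real functions, hence have real inner
products, and `‖c‖² + ‖d‖² = 1`. For these reasons the Lyapunov equation is solved without
diagonalizing `ρ_s`: for `s ≠ 0`, a symmetric logarithmic derivative takes the values
`L c = 2 (∂ᵢc - κ d)` and `L d = 2 (∂ᵢd + κ c)`, with the one real number
`κ = ⟨∂ᵢc, d⟩ - ⟨c, ∂ᵢd⟩` that makes the form Hermitian (`lyapunov_of_apply_eq`,
`inner_eq_of_twist`). A self-adjoint operator with these values exists, since `c` and `d` are
linearly independent, and any other solution agrees with it on `c` and `d`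
(`apply_eq_zero_of_anticomm`); this is all that enters
`Re Tr (ρ_s Lᵢ Π Lⱼ) = Re (⟨Lᵢ c, Π Lⱼ c⟩ + ⟨Lᵢ d, Π Lⱼ d⟩)`. At `s = 0` one has `d = 0` and
`∂ᵢc = 0`, so the quantum Fisher information matrix tends to `4 Re ⟨τᵢ, Π τⱼ⟩`, where
`∂ᵢ⁰Φ = i τᵢ` (`tendsto_qfim`).

The probability is `‖Π c‖² + ‖Π d‖²`. If `Π` is regular, it is stationary at `0` and does not vanish
there, so the classical matrix tends to `0`, and saturation means that `Π τᵢ = 0` for all `i`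
(`saturatedRegular_iff`). If `Π` is null, put `wᵢ = Π ∂ᵢd` and `W = ∑ δᵢ wᵢ`; along `δ` the
probability is `t² ‖W‖² + o(t²)`, and the classical matrix tends to
`4 Re ⟨W, wᵢ⟩ Re ⟨W, wⱼ⟩ / ‖W‖²`. This equals `4 Re ⟨wᵢ, wⱼ⟩` in all directions with `W ≠ 0` if and
only if the `wᵢ` are pairwise real-proportional: coordinate directions give the case of equality in
the Cauchy–Schwarz inequality, and conversely everything is a real multiple of one vector
(`saturatedNull_iff`). If all `wᵢ` vanish, the Cauchy–Schwarz bound `abs_cfim_le` gives the limit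
`0` in every direction.

For the Zernike modes, orthonormality is proved in polar coordinates. The moments of the radial
polynomials are alternating sums which are values of a Lagrange interpolation formula
(`sum_radialCoeff_div`). In Cartesian coordinates the modes are polynomials and span all polynomials
(`polarMonomial_mem_span`, `adjoin_coordFun_le_span`), so by the Stone–Weierstrass theorem nothing
in `L²` of the disc is orthogonal to all of them (`eq_zero_of_inner_zernike`). The derivatives
`∂ᵢ⁰Φ` are multiples of `Z_1^1`, `Z_1^{-1}`, `Z_2^0` (`tangent_eq`), which gives the remaining
claims.
-/


noncomputable section

namespace TwoSources

/-! ### The real and imaginary parts of the pupil function, and their derivatives -/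

theorem memLp_discReal (a : ℝ) (f : C(Plane, ℝ)) :
    MemLp ((Metric.closedBall (0 : Plane) a).indicator fun x => (f x : ℂ)) 2 volume := by
  obtain ⟨C, hC⟩ := (isCompact_closedBall (0 : Plane) a).exists_bound_of_continuousOn
    f.continuous.continuousOn
  refine memLp_disc a (by fun_prop) C fun x hx => ?_
  rw [Complex.norm_real]
  exact hC x hx

/-- The vector of `L²(ℝ²; ℂ)` given by a real continuous function, cut off to the disc of
radius `a`. -/
def discVec (a : ℝ) : C(Plane, ℝ) →ₗ[ℝ] Hilb where
  toFun f := (memLp_discReal a f).toLp _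
  map_add' f g := by
    rw [← MemLp.toLp_add]
    refine MemLp.toLp_congr _ _ (Eventually.of_forall fun x => ?_)
    simp only [Set.indicator, Pi.add_apply, ContinuousMap.add_apply, Complex.ofReal_add]
    split_ifs <;> simp
  map_smul' c f := by
    rw [RingHom.id_apply, ← MemLp.toLp_const_smul]
    refine MemLp.toLp_congr _ _ (Eventually.of_forall fun x => ?_)
    simp only [Set.indicator, Pi.smul_apply, ContinuousMap.smul_apply, smul_eq_mul,
      Complex.ofReal_mul]
    split_ifs <;> simp

theorem coeFn_discVec (a : ℝ) (f : C(Plane, ℝ)) :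
    discVec a f =ᵐ[volume] (Metric.closedBall (0 : Plane) a).indicator fun x => (f x : ℂ) :=
  (memLp_discReal a f).coeFn_toLp

theorem inner_discVec_left (a : ℝ) (f : C(Plane, ℝ)) (v : Hilb) :
    inner ℂ (discVec a f) v = ∫ x in Metric.closedBall (0 : Plane) a, (f x : ℂ) * v x := by
  rw [L2.inner_def, ← integral_indicator measurableSet_closedBall]
  refine integral_congr_ae ?_
  filter_upwards [coeFn_discVec a f] with x hx
  rw [hx]
  by_cases h : x ∈ Metric.closedBall (0 : Plane) a <;> simp [h, mul_comm]

theorem inner_discVec (a : ℝ) (f g : C(Plane, ℝ)) :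
    inner ℂ (discVec a f) (discVec a g) =
      ((∫ x in Metric.closedBall (0 : Plane) a, f x * g x : ℝ) : ℂ) := by
  rw [inner_discVec_left, ← integral_complex_ofReal]
  refine setIntegral_congr_ae measurableSet_closedBall ?_
  filter_upwards [coeFn_discVec a g] with x hx h
  rw [hx, Set.indicator_of_mem h, Complex.ofReal_mul]

theorem inner_discVec_im (a : ℝ) (f g : C(Plane, ℝ)) :
    (inner ℂ (discVec a f) (discVec a g)).im = 0 := by
  rw [inner_discVec, Complex.ofReal_im]

theorem norm_discVec_le (a : ℝ) (f : C(Plane, ℝ)) (C : ℝ)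
    (h : ∀ x ∈ Metric.closedBall (0 : Plane) a, |f x| ≤ C) :
    ‖discVec a f‖ ≤ C * ‖discVec a 1‖ := by
  refine Lp.norm_le_mul_norm_of_ae_le_mul ?_
  filter_upwards [coeFn_discVec a f, coeFn_discVec a 1] with x hf h1
  rw [hf, h1]
  by_cases hx : x ∈ Metric.closedBall (0 : Plane) a
  · simpa [hx] using h x hx
  · simp [hx]

/-- A continuous function whose disc vector is zero vanishes on the open disc: it vanishes almost
everywhere there, and the disc is open. -/
theorem eq_zero_of_discVec_eq_zero {a : ℝ} {f : C(Plane, ℝ)} (h : discVec a f = 0)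
    {x : Plane} (hx : ‖x‖ < a) : f x = 0 := by
  have h0 : (fun x => f x) =ᵐ[volume.restrict (Metric.ball (0 : Plane) a)] fun _ => (0 : ℝ) := by
    rw [EventuallyEq, ae_restrict_iff' measurableSet_ball]
    filter_upwards [coeFn_discVec a f, Lp.coeFn_zero ℂ 2 (volume : Measure Plane)] with y hy hy0 hb
    rw [h, hy0, Set.indicator_of_mem (Metric.ball_subset_closedBall hb)] at hy
    simpa using hy.symm
  exact Measure.eqOn_open_of_ae_eq h0 Metric.isOpen_ball f.continuous.continuousOn
    continuousOn_const (by simpa using hx)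

/-- The phase `k (s_⊥ · r - s₃ r² / 2)` acquired at the point `r` of the pupil. -/
def phase (k : ℝ) : Separation →ₗ[ℝ] C(Plane, ℝ) where
  toFun s := ⟨fun x => k * (s 0 * x 0 + s 1 * x 1 - s 2 * ‖x‖ ^ 2 / 2), by fun_prop⟩
  map_add' s t := by ext x; simp; ring
  map_smul' c s := by ext x; simp; ring

theorem phase_apply (k : ℝ) (s : Separation) (x : Plane) :
    phase k s x = k * (s 0 * x 0 + s 1 * x 1 - s 2 * ‖x‖ ^ 2 / 2) := rfl

theorem abs_phase_le (k a : ℝ) (s : Separation) {x : Plane}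
    (hx : x ∈ Metric.closedBall (0 : Plane) a) :
    |phase k s x| ≤ |k| * (2 * |a| + a ^ 2) * ‖s‖ := by
  have hx' : ‖x‖ ≤ |a| := (by simpa using hx : ‖x‖ ≤ a).trans (le_abs_self a)
  have hs : ∀ i, |s i| ≤ ‖s‖ := fun i => PiLp.norm_apply_le s i
  have hxi : ∀ i, |x i| ≤ |a| := fun i => (PiLp.norm_apply_le x i).trans hx'
  have hx2 : ‖x‖ ^ 2 ≤ a ^ 2 := by rw [← sq_abs a]; gcongr
  have h0 : |s 0 * x 0| ≤ ‖s‖ * |a| := by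
    rw [abs_mul]; exact mul_le_mul (hs 0) (hxi 0) (abs_nonneg _) (norm_nonneg _)
  have h1 : |s 1 * x 1| ≤ ‖s‖ * |a| := by
    rw [abs_mul]; exact mul_le_mul (hs 1) (hxi 1) (abs_nonneg _) (norm_nonneg _)
  have h2 : |s 2 * ‖x‖ ^ 2 / 2| ≤ ‖s‖ * a ^ 2 := by
    rw [abs_div, abs_mul, abs_of_nonneg (sq_nonneg ‖x‖), abs_two]
    have : |s 2| * ‖x‖ ^ 2 ≤ ‖s‖ * a ^ 2 := by gcongr; exact hs 2
    have : 0 ≤ |s 2| * ‖x‖ ^ 2 := by positivity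
    linarith
  rw [phase_apply, abs_mul, mul_assoc]
  gcongr
  calc _ ≤ |s 0 * x 0| + |s 1 * x 1| + |s 2 * ‖x‖ ^ 2 / 2| :=
        (abs_sub _ _).trans (by gcongr; exact abs_add_le _ _)
    _ ≤ _ := by linarith

/-- The disc vector with values `𝒜 φ(phase)`, for a real profile `φ`. For `φ = cos` and `φ = sin`
these are the real and the imaginary part of the pupil function. -/
def wave (k a : ℝ) (φ : C(ℝ, ℝ)) (s : Separation) : Hilb :=
  discVec a ((1 / (Real.sqrt Real.pi * a)) • φ.comp (phase k s))

/-- The derivative of `wave k a φ`, where `ψ` is the derivative of the profile `φ`. -/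
def waveDeriv (k a : ℝ) (ψ : C(ℝ, ℝ)) (s : Separation) : Separation →L[ℝ] Hilb :=
  LinearMap.toContinuousLinearMap
    { toFun := fun h => discVec a ((1 / (Real.sqrt Real.pi * a)) • (phase k h * ψ.comp (phase k s)))
      map_add' := fun h h' => by rw [map_add, add_mul, smul_add, map_add]
      map_smul' := fun c h => by
        rw [map_smul (phase k), smul_mul_assoc, smul_comm, map_smul, RingHom.id_apply] }

theorem waveDeriv_apply (k a : ℝ) (ψ : C(ℝ, ℝ)) (s h : Separation) :
    waveDeriv k a ψ s h =
      discVec a ((1 / (Real.sqrt Real.pi * a)) • (phase k h * ψ.comp (phase k s))) := rfl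

theorem hasFDerivAt_wave (k a : ℝ) {φ ψ : C(ℝ, ℝ)}
    (h : ∀ y t : ℝ, |t| ≤ 1 → |φ (y + t) - φ y - t * ψ y| ≤ t ^ 2) (s : Separation) :
    HasFDerivAt (wave k a φ) (waveDeriv k a ψ s) s := by
  set A := 1 / (Real.sqrt Real.pi * a)
  set M := |k| * (2 * |a| + a ^ 2)
  have hM : 0 ≤ M := by positivity
  rw [hasFDerivAt_iff_isLittleO_nhds_zero]
  refine Asymptotics.IsBigO.trans_isLittleO (g := fun t : Separation => ‖t‖ ^ 2) ?_ ?_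
  · refine Asymptotics.IsBigO.of_bound (|A| * M ^ 2 * ‖discVec a 1‖) ?_
    have : ∀ᶠ t : Separation in 𝓝 0, M * ‖t‖ < 1 := by
      have : Tendsto (fun t : Separation => M * ‖t‖) (𝓝 0) (𝓝 (M * ‖(0 : Separation)‖)) :=
        Continuous.tendsto (by fun_prop) 0
      rw [norm_zero, mul_zero] at this
      exact this.eventually_lt_const one_pos
    filter_upwards [this] with t ht
    rw [wave, wave, waveDeriv_apply, ← map_sub, ← map_sub, ← smul_sub, ← smul_sub]
    refine (norm_discVec_le a _ (|A| * (M * ‖t‖) ^ 2) fun x hx => ?_).trans (le_of_eq ?_)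
    · have hp := abs_phase_le k a t hx
      rw [ContinuousMap.smul_apply, smul_eq_mul, abs_mul]
      gcongr
      refine le_trans ?_ ((sq_abs (phase k t x)).ge.trans (by gcongr))
      simpa using h (phase k s x) (phase k t x) (hp.trans ht.le)
    · rw [norm_pow, norm_norm]; ring
  · simpa using (Asymptotics.isLittleO_norm_pow_id one_lt_two :
      (fun t : Separation => ‖t‖ ^ 2) =o[𝓝 0] _)

theorem continuous_waveDeriv (k a : ℝ) {ψ : C(ℝ, ℝ)}
    (hψ : ∀ y t : ℝ, |ψ (y + t) - ψ y| ≤ |t|) (h : Separation) :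
    Continuous fun s => waveDeriv k a ψ s h := by
  set A := 1 / (Real.sqrt Real.pi * a)
  set M := |k| * (2 * |a| + a ^ 2)
  have hM : 0 ≤ M := by positivity
  rw [continuous_iff_continuousAt]
  intro s
  rw [ContinuousAt, tendsto_iff_norm_sub_tendsto_zero]
  have hlim : Tendsto (fun t => |A| * (M * ‖h‖ * (M * ‖t - s‖)) * ‖discVec a 1‖) (𝓝 s) (𝓝 0) := by
    have : Continuous fun t => |A| * (M * ‖h‖ * (M * ‖t - s‖)) * ‖discVec a 1‖ := by fun_prop
    simpa using this.tendsto s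
  refine squeeze_zero (fun _ => norm_nonneg _) (fun t => ?_) hlim
  rw [waveDeriv_apply, waveDeriv_apply, ← map_sub, ← smul_sub, ← mul_sub]
  refine norm_discVec_le a _ _ fun x hx => ?_
  rw [ContinuousMap.smul_apply, smul_eq_mul, abs_mul]
  gcongr
  rw [ContinuousMap.mul_apply, abs_mul]
  gcongr
  · exact abs_phase_le k a h hx
  · refine le_trans ?_ (abs_phase_le k a (t - s) hx)
    have := hψ (phase k s x) (phase k (t - s) x)
    simpa [map_sub] using this

theorem cos_sin_taylor (y t : ℝ) (ht : |t| ≤ 1) :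
    |Real.cos (y + t) - Real.cos y + t * Real.sin y| ≤ t ^ 2 ∧
      |Real.sin (y + t) - Real.sin y - t * Real.cos y| ≤ t ^ 2 := by
  have h1 : ‖Complex.exp ((t : ℂ) * Complex.I) - 1 - (t : ℂ) * Complex.I‖ ≤ t ^ 2 := by
    have := Complex.norm_exp_sub_one_sub_id_le (x := (t : ℂ) * Complex.I) (by simpa using ht)
    simpa using this
  have h2 : ‖Complex.exp ((y : ℂ) * Complex.I) *
      (Complex.exp ((t : ℂ) * Complex.I) - 1 - (t : ℂ) * Complex.I)‖ ≤ t ^ 2 := by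
    rwa [norm_mul, Complex.norm_exp_ofReal_mul_I, one_mul]
  refine ⟨(le_of_eq ?_).trans ((Complex.abs_re_le_norm _).trans h2),
    (le_of_eq ?_).trans ((Complex.abs_im_le_norm _).trans h2)⟩ <;> congr 1 <;>
    simp [Complex.exp_mul_I, ← Complex.ofReal_cos, ← Complex.ofReal_sin, Real.cos_add,
      Real.sin_add] <;> ring

/-- The cosine as a bundled continuous map. -/
def cosMap : C(ℝ, ℝ) := ⟨Real.cos, Real.continuous_cos⟩

/-- The sine as a bundled continuous map. -/
def sinMap : C(ℝ, ℝ) := ⟨Real.sin, Real.continuous_sin⟩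

/-- The real part of the pupil function, `𝒜 cos(phase)` on the disc. -/
def cosVec (k a : ℝ) : Separation → Hilb := wave k a cosMap

/-- The imaginary part of the pupil function, `𝒜 sin(phase)` on the disc. -/
def sinVec (k a : ℝ) : Separation → Hilb := wave k a sinMap

/-- The derivative of `cosVec`. -/
def cosDeriv (k a : ℝ) : Separation → Separation →L[ℝ] Hilb := waveDeriv k a (-sinMap)

/-- The derivative of `sinVec`. -/
def sinDeriv (k a : ℝ) : Separation → Separation →L[ℝ] Hilb := waveDeriv k a cosMap

theorem hasFDerivAt_cosVec (k a : ℝ) (s : Separation) :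
    HasFDerivAt (cosVec k a) (cosDeriv k a s) s :=
  hasFDerivAt_wave k a (fun y t ht => by simpa [cosMap, sinMap] using (cos_sin_taylor y t ht).1) s

theorem hasFDerivAt_sinVec (k a : ℝ) (s : Separation) :
    HasFDerivAt (sinVec k a) (sinDeriv k a s) s :=
  hasFDerivAt_wave k a (fun y t ht => by simpa [cosMap, sinMap] using (cos_sin_taylor y t ht).2) s

theorem continuous_cosDeriv (k a : ℝ) (h : Separation) : Continuous fun s => cosDeriv k a s h :=
  continuous_waveDeriv k a (fun y t => by
    have := Real.abs_sin_sub_sin_le (y + t) y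
    simpa [sinMap, neg_add_eq_sub, abs_sub_comm] using this) h

theorem continuous_sinDeriv (k a : ℝ) (h : Separation) : Continuous fun s => sinDeriv k a s h :=
  continuous_waveDeriv k a (fun y t => by
    have := Real.abs_cos_sub_cos_le (y + t) y
    simpa [cosMap] using this) h

theorem continuous_cosVec (k a : ℝ) : Continuous (cosVec k a) :=
  continuous_iff_continuousAt.2 fun s => (hasFDerivAt_cosVec k a s).continuousAt

theorem continuous_sinVec (k a : ℝ) : Continuous (sinVec k a) :=
  continuous_iff_continuousAt.2 fun s => (hasFDerivAt_sinVec k a s).continuousAt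

theorem cosDeriv_zero (k a : ℝ) (h : Separation) : cosDeriv k a 0 h = 0 := by
  have : phase k h * (-sinMap).comp (phase k 0) = 0 := by
    ext x; simp [sinMap]
  rw [cosDeriv, waveDeriv_apply, this, smul_zero, map_zero]

theorem sinDeriv_zero (k a : ℝ) (h : Separation) :
    sinDeriv k a 0 h = discVec a ((1 / (Real.sqrt Real.pi * a)) • phase k h) := by
  have : phase k h * cosMap.comp (phase k 0) = phase k h := by
    ext x; simp [cosMap]
  rw [sinDeriv, waveDeriv_apply, this]

theorem cosVec_zero (k a : ℝ) :
    cosVec k a 0 = discVec a ((1 / (Real.sqrt Real.pi * a)) • 1) := by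
  have : cosMap.comp (phase k 0) = 1 := by
    ext x; simp [cosMap]
  rw [cosVec, wave, this]

theorem sinVec_zero (k a : ℝ) : sinVec k a 0 = 0 := by
  have : sinMap.comp (phase k 0) = 0 := by
    ext x; simp [sinMap]
  rw [sinVec, wave, this, smul_zero, map_zero]

/-- The pupil function is `c + i d` with real `c`, `d`. -/
theorem pupil_eq (k a : ℝ) (s : Separation) :
    pupil k a s = cosVec k a s + Complex.I • sinVec k a s := by
  refine Lp.ext ?_
  filter_upwards [(memLp_pupilFun k a s).coeFn_toLp,
    coeFn_discVec a ((1 / (Real.sqrt Real.pi * a)) • cosMap.comp (phase k s)),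
    coeFn_discVec a ((1 / (Real.sqrt Real.pi * a)) • sinMap.comp (phase k s)),
    Lp.coeFn_add (cosVec k a s) (Complex.I • sinVec k a s),
    Lp.coeFn_smul Complex.I (sinVec k a s)] with x h1 h2 h3 h4 h5
  rw [pupil, h1, h4, Pi.add_apply, h5, Pi.smul_apply, cosVec, sinVec, wave, wave, h2, h3, pupilFun]
  by_cases hx : x ∈ Metric.closedBall (0 : Plane) a
  · simp only [Set.indicator_of_mem hx, pupilPhase, ← phase_apply]
    rw [mul_comm Complex.I, Complex.exp_mul_I]
    simp [cosMap, sinMap]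
    ring
  · simp [hx]

theorem pupil_neg (k a : ℝ) (s : Separation) :
    pupil k a (-s) = cosVec k a s - Complex.I • sinVec k a s := by
  have h1 : cosMap.comp (phase k (-s)) = cosMap.comp (phase k s) := by
    ext x; simp [cosMap]
  have h2 : sinMap.comp (phase k (-s)) = -sinMap.comp (phase k s) := by
    ext x; simp [sinMap]
  rw [pupil_eq, cosVec, sinVec, wave, wave, wave, wave, h1, h2, smul_neg, map_neg, smul_neg,
    sub_eq_add_neg]

theorem hasFDerivAt_pupil (k a : ℝ) (s : Separation) :
    HasFDerivAt (pupil k a) (cosDeriv k a s + Complex.I • sinDeriv k a s) s := by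
  have : pupil k a = fun s => cosVec k a s + Complex.I • sinVec k a s := funext (pupil_eq k a)
  rw [this]
  exact (hasFDerivAt_cosVec k a s).add ((hasFDerivAt_sinVec k a s).const_smul Complex.I)

theorem dPupil_eq (k a : ℝ) (i : Fin 3) :
    dPupil k a i = Complex.I • sinDeriv k a 0 (dir i) := by
  rw [dPupil, (hasFDerivAt_pupil k a 0).hasLineDerivAt _ |>.lineDeriv]
  simp [cosDeriv_zero]

theorem pupil_zero (k a : ℝ) : pupil k a 0 = cosVec k a 0 := by
  rw [pupil_eq, sinVec_zero, smul_zero, add_zero]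

theorem norm_pupil {k a : ℝ} (ha : 0 < a) (s : Separation) :
    ‖cosVec k a s‖ ^ 2 + ‖sinVec k a s‖ ^ 2 = 1 := by
  have hv : (volume (Metric.closedBall (0 : Plane) a)).toReal = a ^ 2 * Real.pi := by
    rw [EuclideanSpace.volume_closedBall_fin_two, ENNReal.toReal_mul, ENNReal.toReal_pow,
      ENNReal.toReal_ofReal ha.le]
    simp [Real.pi_pos.le]
  have hn : ∀ f : C(Plane, ℝ), ‖discVec a f‖ ^ 2 =
      ∫ x in Metric.closedBall (0 : Plane) a, f x * f x := fun f => by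
    have := inner_self_eq_norm_sq_to_K (𝕜 := ℂ) (discVec a f)
    rw [inner_discVec, RCLike.ofReal_eq_complex_ofReal, ← Complex.ofReal_pow] at this
    exact (Complex.ofReal_injective this).symm
  have hi : ∀ f : C(Plane, ℝ),
      IntegrableOn (fun x => f x * f x) (Metric.closedBall (0 : Plane) a) :=
    fun f => (by fun_prop : Continuous fun x => f x * f x).continuousOn.integrableOn_compact
      (isCompact_closedBall 0 a)
  rw [cosVec, sinVec, wave, wave, hn, hn, ← integral_add (hi _) (hi _)]
  have : ∀ x, ((1 / (Real.sqrt Real.pi * a)) • cosMap.comp (phase k s)) x *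
      ((1 / (Real.sqrt Real.pi * a)) • cosMap.comp (phase k s)) x +
      ((1 / (Real.sqrt Real.pi * a)) • sinMap.comp (phase k s)) x *
      ((1 / (Real.sqrt Real.pi * a)) • sinMap.comp (phase k s)) x =
      1 / (Real.pi * a ^ 2) := fun x => by
    have h1 := Real.cos_sq_add_sin_sq (phase k s x)
    have h2 := Real.sq_sqrt Real.pi_pos.le
    calc _ = (1 / (Real.sqrt Real.pi * a)) ^ 2 *
        (Real.cos (phase k s x) ^ 2 + Real.sin (phase k s x) ^ 2) := by
          simp only [ContinuousMap.smul_apply, ContinuousMap.comp_apply, smul_eq_mul, cosMap,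
            sinMap, ContinuousMap.coe_mk]
          ring
      _ = _ := by rw [h1, div_pow, mul_pow, h2]; ring
  simp only [this]
  rw [setIntegral_const, Measure.real, hv, smul_eq_mul]
  field_simp

/-! ### Operators of rank one and the Lyapunov equation -/

section Abstract

open InnerProductSpace ContinuousLinearMap

variable {E : Type*} [NormedAddCommGroup E] [InnerProductSpace ℂ E]

theorem hasSum_trace_rankOne {w : Set E} (b : HilbertBasis w ℂ E) (hb : ⇑b = ((↑) : w → E))
    (x y : E) :
    HasSum (fun e : w => inner ℂ (e : E) (rankOne ℂ x y (e : E))) (inner ℂ y x) := by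
  have h := b.hasSum_inner_mul_inner y x
  rw [hb] at h
  simpa only [rankOne_apply, inner_smul_right] using h

theorem tsum_trace_rankOne_add {w : Set E} (b : HilbertBasis w ℂ E) (hb : ⇑b = ((↑) : w → E))
    (x y z u : E) :
    ∑' e : w, inner ℂ (e : E) ((rankOne ℂ x y + rankOne ℂ z u) (e : E)) =
      inner ℂ y x + inner ℂ u z := by
  have h := (hasSum_trace_rankOne b hb x y).add (hasSum_trace_rankOne b hb z u)
  simpa only [add_apply, inner_add_right] using h.tsum_eq

theorem mul_rankOne (T : E →L[ℂ] E) (x y : E) : T * rankOne ℂ x y = rankOne ℂ (T x) y :=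
  comp_rankOne x y T

theorem half_rankOne_add_half_rankOne (c d : E) :
    (1 / 2 : ℂ) • rankOne ℂ (c + Complex.I • d) (c + Complex.I • d) +
      (1 / 2 : ℂ) • rankOne ℂ (c - Complex.I • d) (c - Complex.I • d) =
    rankOne ℂ c c + rankOne ℂ d d := by
  ext1 x
  have hI : Complex.I * Complex.I = -1 := Complex.I_mul_I
  simp only [add_apply, smul_apply, rankOne_apply, inner_add_left, inner_sub_left, inner_smul_left,
    Complex.conj_I]
  match_scalars
  · ring
  · linear_combination (-inner ℂ d x) * hI

theorem exists_inner_eq_one {x y : E} (h : ∀ t : ℂ, x ≠ t • y) :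
    ∃ u : E, inner ℂ u x = 1 ∧ inner ℂ u y = 0 := by
  set p := x - (ℂ ∙ y).starProjection x
  have hp : p ≠ 0 := by
    intro h0
    obtain ⟨t, ht⟩ :=
      Submodule.mem_span_singleton.1 (Submodule.starProjection_apply_mem (ℂ ∙ y) x)
    exact h t (by rw [ht]; exact sub_eq_zero.1 h0)
  have hpy : ∀ w ∈ ℂ ∙ y, inner ℂ p w = 0 := fun w hw =>
    Submodule.starProjection_inner_eq_zero x w hw
  have hpx : inner ℂ p x = (‖p‖ : ℂ) ^ 2 := by
    have h1 : x = p + (ℂ ∙ y).starProjection x := by simp [p]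
    rw [h1, inner_add_right, hpy _ (Submodule.starProjection_apply_mem _ _), add_zero]
    exact inner_self_eq_norm_sq_to_K p
  have hn : (‖p‖ : ℂ) ^ 2 ≠ 0 := by simpa using hp
  refine ⟨((‖p‖ : ℂ) ^ 2)⁻¹ • p, ?_, ?_⟩
  · rw [inner_smul_left, hpx, map_inv₀, map_pow, Complex.conj_ofReal, inv_mul_cancel₀ hn]
  · rw [inner_smul_left, hpy _ (Submodule.mem_span_singleton_self y), mul_zero]

/-- The Hermiticity condition that fixes `κ`, for a pair `c`, `d` with real Gram matrix of
trace one. -/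
theorem inner_eq_of_twist {c d c' d' : E} {κ : ℝ} (h1 : inner ℂ c c + inner ℂ d d = (1 : ℂ))
    (hc : inner ℂ c' d - inner ℂ c d' = (κ : ℂ)) :
    inner ℂ ((2 : ℂ) • (c' - (κ : ℂ) • d)) d = inner ℂ c ((2 : ℂ) • (d' + (κ : ℂ) • c)) := by
  simp only [inner_smul_left, inner_smul_right, inner_sub_left, inner_add_right,
    Complex.conj_ofReal, map_ofNat]
  linear_combination 2 * hc - 2 * κ * h1

theorem hasLineDerivAt_rankOne {F : Type*} [NormedAddCommGroup F] [NormedSpace ℝ F] {f : F → E}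
    {f' : F →L[ℝ] E} {s : F} (hf : HasFDerivAt f f' s) (h : F) :
    HasLineDerivAt ℝ (fun s => (rankOne ℂ (f s) (f s) : E →L[ℂ] E))
      (rankOne ℂ (f s) (f' h) + rankOne ℂ (f' h) (f s)) s h := by
  have hb : IsBoundedBilinearMap ℝ fun p : E × E => (rankOne ℂ p.1 p.2 : E →L[ℂ] E) :=
    { add_left := fun x x' y => by simp
      smul_left := fun c x y => by
        ext1 z
        exact smul_comm (inner ℂ y z) c x
      add_right := fun x y y' => by simp
      smul_right := fun c x y => by
        ext1 z
        change inner ℂ (c • y) z • x = c • inner ℂ y z • x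
        rw [← Complex.coe_smul c y, inner_smul_left, Complex.conj_ofReal, mul_smul,
          Complex.coe_smul]
      bound := ⟨1, one_pos, fun x y => by simp⟩ }
  have h1 := ((hb.hasFDerivAt (f s, f s)).comp s (hf.prodMk hf)).hasLineDerivAt h
  simpa [Function.comp_def] using h1

variable [CompleteSpace E]

theorem inner_map_comm {T : E →L[ℂ] E} (hT : IsSelfAdjoint T) (x y : E) :
    inner ℂ (T x) y = inner ℂ x (T y) := by
  rw [← adjoint_inner_left, hT.adjoint_eq]

theorem rankOne_mul {T : E →L[ℂ] E} (hT : IsSelfAdjoint T) (x y : E) :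
    rankOne ℂ x y * T = rankOne ℂ x (T y) := by
  rw [mul_def, rankOne_comp, hT.adjoint_eq]

/-- Only one operator on the range of `ρ = |c⟩⟨c| + |d⟩⟨d|` solves the Lyapunov equation: if
`M ρ + ρ M = 0` then `Tr (M ρ M) + Tr (ρ M²) = 0`, and both traces are `‖M c‖² + ‖M d‖²`. -/
theorem apply_eq_zero_of_anticomm {c d : E} {M : E →L[ℂ] E} (hM : IsSelfAdjoint M)
    (h : M * (rankOne ℂ c c + rankOne ℂ d d) + (rankOne ℂ c c + rankOne ℂ d d) * M = 0) :
    M c = 0 ∧ M d = 0 := by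
  have h1 : (M * (rankOne ℂ c c + rankOne ℂ d d) +
      (rankOne ℂ c c + rankOne ℂ d d) * M) * M = 0 := by
    rw [h, zero_mul]
  simp only [mul_add, add_mul, mul_rankOne, rankOne_mul hM] at h1
  obtain ⟨w, b, hb⟩ := exists_hilbertBasis ℂ E
  have h2 := ((hasSum_trace_rankOne b hb (M c) (M c)).add
    (hasSum_trace_rankOne b hb (M d) (M d))).add
    ((hasSum_trace_rankOne b hb c (M (M c))).add (hasSum_trace_rankOne b hb d (M (M d))))
  have h3 : ∀ e : w, inner ℂ (e : E) (rankOne ℂ (M c) (M c) (e : E)) +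
      inner ℂ (e : E) (rankOne ℂ (M d) (M d) (e : E)) +
      (inner ℂ (e : E) (rankOne ℂ c (M (M c)) (e : E)) +
      inner ℂ (e : E) (rankOne ℂ d (M (M d)) (e : E))) = 0 := fun e => by
    have := congrArg (fun T : E →L[ℂ] E => inner ℂ (e : E) (T e)) h1
    simpa only [add_apply, inner_add_right, zero_apply, inner_zero_right] using this
  simp only [h3] at h2
  have h4 := h2.unique hasSum_zero
  rw [inner_map_comm hM (M c), inner_map_comm hM (M d), inner_self_eq_norm_sq_to_K,
    inner_self_eq_norm_sq_to_K] at h4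
  have h5 : ‖M c‖ ^ 2 + ‖M d‖ ^ 2 = 0 := by
    have : (‖M c‖ ^ 2 + ‖M d‖ ^ 2) + (‖M c‖ ^ 2 + ‖M d‖ ^ 2) = (0 : ℝ) := by
      apply Complex.ofReal_injective
      push_cast
      exact h4
    linarith
  have hc := sq_nonneg ‖M c‖
  have hd := sq_nonneg ‖M d‖
  constructor
  · exact norm_eq_zero.1 (pow_eq_zero_iff two_ne_zero |>.1 (by linarith))
  · exact norm_eq_zero.1 (pow_eq_zero_iff two_ne_zero |>.1 (by linarith))

/-- A self-adjoint operator may be prescribed on two independent vectors, if the prescribed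
form is Hermitian. -/
theorem exists_isSelfAdjoint_apply_eq {x y X Y : E} (hxy : ∀ t : ℂ, x ≠ t • y)
    (hyx : ∀ t : ℂ, y ≠ t • x) (hxX : inner ℂ X x = inner ℂ x X) (hyY : inner ℂ Y y = inner ℂ y Y)
    (hXy : inner ℂ X y = inner ℂ x Y) :
    ∃ L : E →L[ℂ] E, IsSelfAdjoint L ∧ L x = X ∧ L y = Y := by
  obtain ⟨u, hux, huy⟩ := exists_inner_eq_one hxy
  obtain ⟨v, hvy, hvx⟩ := exists_inner_eq_one hyx
  have hYx : inner ℂ Y x = inner ℂ y X := by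
    rw [← inner_conj_symm, ← hXy, inner_conj_symm]
  refine ⟨rankOne ℂ X u + rankOne ℂ Y v + rankOne ℂ u X + rankOne ℂ v Y -
    (inner ℂ x X • rankOne ℂ u u + inner ℂ x Y • rankOne ℂ u v + inner ℂ y X • rankOne ℂ v u +
      inner ℂ y Y • rankOne ℂ v v), ?_, ?_, ?_⟩
  · rw [isSelfAdjoint_iff']
    simp only [map_add, map_sub, map_smulₛₗ, adjoint_rankOne, inner_conj_symm, hxX, hyY, hXy, hYx]
    abel
  · simp only [sub_apply, add_apply, smul_apply, rankOne_apply, hux, hvx, hxX, hYx]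
    module
  · simp only [sub_apply, add_apply, smul_apply, rankOne_apply, huy, hvy, hyY, hXy]
    module

/-- Twice the Lyapunov equation for the derivative of `|c⟩⟨c| + |d⟩⟨d|`: the operator with
`L c = 2 (c' - κ d)` and `L d = 2 (d' + κ c)` solves it for every real `κ`. -/
theorem lyapunov_of_apply_eq {c d c' d' : E} {κ : ℝ} {L : E →L[ℂ] E} (hL : IsSelfAdjoint L)
    (hc : L c = (2 : ℂ) • (c' - (κ : ℂ) • d)) (hd : L d = (2 : ℂ) • (d' + (κ : ℂ) • c)) :
    (1 / 2 : ℂ) • (L * (rankOne ℂ c c + rankOne ℂ d d) + (rankOne ℂ c c + rankOne ℂ d d) * L) =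
      (rankOne ℂ c c' + rankOne ℂ c' c) + (rankOne ℂ d d' + rankOne ℂ d' d) := by
  rw [mul_add, add_mul, mul_rankOne, mul_rankOne, rankOne_mul hL, rankOne_mul hL, hc, hd]
  ext1 x
  simp only [add_apply, smul_apply, rankOne_apply, inner_add_left, inner_sub_left, inner_smul_left,
    Complex.conj_ofReal, map_ofNat]
  module

end Abstract

/-! ### The state, its symmetric logarithmic derivatives, and the quantum Fisher information -/

section State

open InnerProductSpace

/-- The operator `|x⟩⟨y|` on the one-photon space. -/
def ketbra (x y : Hilb) : Op := rankOne ℂ x y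

theorem opTrace_ketbra_add (x y z u : Hilb) :
    opTrace (ketbra x y + ketbra z u) = inner ℂ y x + inner ℂ u z :=
  have ⟨b, hb⟩ := (exists_hilbertBasis ℂ Hilb).choose_spec
  tsum_trace_rankOne_add b hb x y z u

theorem half_ketbra_add_half_ketbra (c d : Hilb) :
    (1 / 2 : ℂ) • ketbra (c + Complex.I • d) (c + Complex.I • d) +
      (1 / 2 : ℂ) • ketbra (c - Complex.I • d) (c - Complex.I • d) =
    ketbra c c + ketbra d d := half_rankOne_add_half_rankOne c d

theorem ketbra_mul (T : Op) (x y : Hilb) :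
    ketbra x y * T = ketbra x (ContinuousLinearMap.adjoint T y) :=
  rankOne_comp x y T

/-- In terms of the real and the imaginary part of the pupil function the state has no complex
coefficients left. -/
theorem rho_eq (k a : ℝ) (s : Separation) :
    rho k a s = ketbra (cosVec k a s) (cosVec k a s) + ketbra (sinVec k a s) (sinVec k a s) := by
  rw [← half_ketbra_add_half_ketbra, ← pupil_eq, ← pupil_neg]
  rfl

theorem hasLineDerivAt_ketbra {f : Separation → Hilb} {f' : Separation →L[ℝ] Hilb} {s : Separation}
    (hf : HasFDerivAt f f' s) (h : Separation) :
    HasLineDerivAt ℝ (fun s => ketbra (f s) (f s))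
      (ketbra (f s) (f' h) + ketbra (f' h) (f s)) s h :=
  hasLineDerivAt_rankOne hf h

theorem lineDeriv_rho (k a : ℝ) (s h : Separation) :
    lineDeriv ℝ (rho k a) s h =
      (ketbra (cosVec k a s) (cosDeriv k a s h) + ketbra (cosDeriv k a s h) (cosVec k a s)) +
      (ketbra (sinVec k a s) (sinDeriv k a s h) + ketbra (sinDeriv k a s h) (sinVec k a s)) := by
  rw [funext (rho_eq k a)]
  exact HasLineDerivAt.lineDeriv (HasDerivAt.add
    (hasLineDerivAt_ketbra (hasFDerivAt_cosVec k a s) h)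
    (hasLineDerivAt_ketbra (hasFDerivAt_sinVec k a s) h))

/-- The number `κ = ⟨∂c, d⟩ - ⟨c, ∂d⟩`, with derivatives in the direction `h`. It is the angular
velocity at which the pair `(c, d)` has to be rotated for the matrix elements `⟨L c, d⟩` and
`⟨c, L d⟩` of the symmetric logarithmic derivative to agree. -/
def twist (k a : ℝ) (s h : Separation) : ℝ :=
  (inner ℂ (cosDeriv k a s h) (sinVec k a s)).re - (inner ℂ (cosVec k a s) (sinDeriv k a s h)).re

/-- The value at `c` of every symmetric logarithmic derivative, for `s ≠ 0`. -/
def sldCos (k a : ℝ) (s h : Separation) : Hilb :=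
  (2 : ℂ) • (cosDeriv k a s h - (twist k a s h : ℂ) • sinVec k a s)

/-- The value at `d` of every symmetric logarithmic derivative, for `s ≠ 0`. At `s = 0`, where
`d = 0`, it is the limit of these values. -/
def sldSin (k a : ℝ) (s h : Separation) : Hilb :=
  (2 : ℂ) • (sinDeriv k a s h + (twist k a s h : ℂ) • cosVec k a s)

theorem isSLD_of_apply {k a : ℝ} {s : Separation} {i : Fin 3} {L : Op} (hL : IsSelfAdjoint L)
    (hc : L (cosVec k a s) = sldCos k a s (dir i)) (hd : L (sinVec k a s) = sldSin k a s (dir i)) :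
    IsSLD k a s i L := by
  refine ⟨hL, ?_⟩
  rw [rho_eq, lineDeriv_rho]
  exact lyapunov_of_apply_eq hL hc hd

theorem IsSLD.apply_eq {k a : ℝ} {s : Separation} {i : Fin 3} {L L' : Op} (h : IsSLD k a s i L)
    (h' : IsSLD k a s i L') :
    L (cosVec k a s) = L' (cosVec k a s) ∧ L (sinVec k a s) = L' (sinVec k a s) := by
  have h4 : L * rho k a s + rho k a s * L = L' * rho k a s + rho k a s * L' :=
    smul_right_injective Op (by norm_num : (1 / 2 : ℂ) ≠ 0) (h.2.trans h'.2.symm)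
  have h2 : (L - L') * rho k a s + rho k a s * (L - L') = 0 := by
    rw [sub_mul, mul_sub, ← sub_eq_zero.2 h4]
    abel
  rw [rho_eq] at h2
  have h3 := apply_eq_zero_of_anticomm (h.1.sub h'.1) h2
  exact ⟨sub_eq_zero.1 h3.1, sub_eq_zero.1 h3.2⟩

theorem discVec_eq_smul {a : ℝ} {f g : C(Plane, ℝ)} {t : ℂ} (h : discVec a f = t • discVec a g) :
    ∃ r : ℝ, discVec a (f - r • g) = 0 := by
  by_cases hg : discVec a g = 0
  · exact ⟨0, by rw [zero_smul, sub_zero, h, hg, smul_zero]⟩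
  have him : t.im = 0 := by
    have h1 := congrArg Complex.im (congrArg (inner ℂ (discVec a g)) h)
    rw [inner_smul_right, inner_discVec_im, inner_discVec, Complex.im_mul_ofReal,
      zero_eq_mul] at h1
    refine h1.resolve_right fun h2 => hg ?_
    rw [← inner_self_eq_zero (𝕜 := ℂ), inner_discVec, h2, Complex.ofReal_zero]
  refine ⟨t.re, ?_⟩
  have : t • discVec a g = t.re • discVec a g := by
    rw [(Complex.ext rfl him : t = (t.re : ℂ))]
    rfl
  rw [map_sub, map_smul, h, this, sub_self]

theorem eq_zero_of_sin_phase {k a : ℝ} (hk : k ≠ 0) (ha : 0 < a) {s : Separation}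
    (h : ∀ x : Plane, ‖x‖ < a → Real.sin (phase k s x) = 0) : s = 0 := by
  have h0 : phase k s 0 = 0 := by simp [phase_apply]
  have h1 : ∀ᶠ x in 𝓝 (0 : Plane), phase k s x = 0 := by
    have hc : Tendsto (fun x => phase k s x) (𝓝 0) (𝓝 0) := by
      simpa only [h0] using (phase k s).continuous.tendsto 0
    filter_upwards [hc.eventually_lt_const Real.pi_pos,
      hc.eventually_const_lt (neg_lt_zero.2 Real.pi_pos), Metric.ball_mem_nhds _ ha] with x h1 h2 h3
    exact (Real.sin_eq_zero_iff_of_lt_of_lt h2 h1).1 (h x (by simpa using h3))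
  obtain ⟨ε, hε, hb⟩ := Metric.eventually_nhds_iff.1 h1
  have hp : ∀ i (t : ℝ), |t| < ε → phase k s (EuclideanSpace.single i t) = 0 := fun i t ht =>
    hb (by simpa using ht)
  have he : |ε / 2| < ε := by rw [abs_of_pos (by positivity)]; linarith
  have e1 := hp 0 (ε / 2) he
  have e2 := hp 0 (-(ε / 2)) (by rwa [abs_neg])
  have e3 := hp 1 (ε / 2) he
  simp [phase_apply, hk] at e1 e2 e3
  rw [abs_of_pos hε] at e1 e2 e3
  have s0 : s 0 = 0 := by
    have : s 0 * ε = 0 := by linarith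
    exact (mul_eq_zero.1 this).resolve_right hε.ne'
  have s2 : s 2 = 0 := by
    have : s 2 * (ε / 2) ^ 2 = 0 := by rw [s0] at e1; linarith
    exact (mul_eq_zero.1 this).resolve_right (by positivity)
  have s1 : s 1 = 0 := by
    have : s 1 * ε = 0 := by rw [s2] at e3; linarith
    exact (mul_eq_zero.1 this).resolve_right hε.ne'
  ext i
  fin_cases i
  exacts [s0, s1, s2]

theorem cosVec_ne_smul {k a : ℝ} (ha : 0 < a) (s : Separation) (t : ℂ) :
    cosVec k a s ≠ t • sinVec k a s := by
  intro h
  obtain ⟨r, hr⟩ := discVec_eq_smul h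
  have h1 := eq_zero_of_discVec_eq_zero hr (x := 0) (by simpa using ha)
  have h0 : phase k s 0 = 0 := by simp [phase_apply]
  simp [cosMap, sinMap, h0, ha.ne', Real.pi_pos.not_ge, Real.sqrt_eq_zero'] at h1

theorem sinVec_ne_smul {k a : ℝ} (hk : k ≠ 0) (ha : 0 < a) {s : Separation} (hs : s ≠ 0) (t : ℂ) :
    sinVec k a s ≠ t • cosVec k a s := by
  intro h
  obtain ⟨r, hr⟩ := discVec_eq_smul h
  have h1 := fun x => eq_zero_of_discVec_eq_zero hr (x := x)
  have h0 : phase k s 0 = 0 := by simp [phase_apply]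
  have hA : 1 / (Real.sqrt Real.pi * a) ≠ 0 := by positivity
  have hr0 : r = 0 := by
    have := h1 0 (by simpa using ha)
    simpa [cosMap, sinMap, h0, ha.ne', Real.pi_pos.not_ge, Real.sqrt_eq_zero'] using this
  subst hr0
  refine hs (eq_zero_of_sin_phase hk ha fun x hx => ?_)
  have := h1 x hx
  rw [zero_smul, sub_zero, ContinuousMap.smul_apply, smul_eq_mul] at this
  exact (mul_eq_zero.1 this).resolve_left hA

theorem inner_discVec_comm (a : ℝ) (f g : C(Plane, ℝ)) :
    inner ℂ (discVec a f) (discVec a g) = inner ℂ (discVec a g) (discVec a f) := by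
  simp only [inner_discVec, mul_comm]

theorem inner_discVec_re (a : ℝ) (f g : C(Plane, ℝ)) :
    ((inner ℂ (discVec a f) (discVec a g)).re : ℂ) = inner ℂ (discVec a f) (discVec a g) := by
  rw [inner_discVec, Complex.ofReal_re]

theorem inner_twist {k a : ℝ} (s h : Separation) :
    inner ℂ (cosDeriv k a s h) (sinVec k a s) - inner ℂ (cosVec k a s) (sinDeriv k a s h) =
      (twist k a s h : ℂ) := by
  rw [twist, Complex.ofReal_sub]
  exact (congrArg₂ _ (inner_discVec_re _ _ _) (inner_discVec_re _ _ _)).symm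

theorem discVec_smul_complex (a : ℝ) (r : ℝ) (f : C(Plane, ℝ)) :
    (r : ℂ) • discVec a f = discVec a (r • f) := by
  rw [map_smul]
  rfl

theorem exists_isSLD_apply {k a : ℝ} (hk : k ≠ 0) (ha : 0 < a) {s : Separation} (hs : s ≠ 0)
    (i : Fin 3) : ∃ L, IsSLD k a s i L ∧ L (cosVec k a s) = sldCos k a s (dir i) ∧
      L (sinVec k a s) = sldSin k a s (dir i) := by
  have hc : ∃ f, sldCos k a s (dir i) = discVec a f :=
    ⟨_, by
      rw [sldCos, cosDeriv, waveDeriv_apply, sinVec, wave, discVec_smul_complex, ← map_sub,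
        ← Complex.ofReal_ofNat, discVec_smul_complex]⟩
  have hd : ∃ f, sldSin k a s (dir i) = discVec a f :=
    ⟨_, by
      rw [sldSin, sinDeriv, waveDeriv_apply, cosVec, wave, discVec_smul_complex, ← map_add,
        ← Complex.ofReal_ofNat, discVec_smul_complex]⟩
  have h1 : inner ℂ (cosVec k a s) (cosVec k a s) + inner ℂ (sinVec k a s) (sinVec k a s) =
      (1 : ℂ) := by
    rw [inner_self_eq_norm_sq_to_K, inner_self_eq_norm_sq_to_K, ← RCLike.ofReal_pow,
      ← RCLike.ofReal_pow, ← RCLike.ofReal_add, norm_pupil ha, RCLike.ofReal_one]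
  have h2 : inner ℂ (sldCos k a s (dir i)) (sinVec k a s) =
      inner ℂ (cosVec k a s) (sldSin k a s (dir i)) :=
    inner_eq_of_twist h1 (inner_twist s (dir i))
  have hcc : inner ℂ (sldCos k a s (dir i)) (cosVec k a s) =
      inner ℂ (cosVec k a s) (sldCos k a s (dir i)) := by
    obtain ⟨f, hf⟩ := hc
    rw [hf]
    exact inner_discVec_comm _ _ _
  have hdd : inner ℂ (sldSin k a s (dir i)) (sinVec k a s) =
      inner ℂ (sinVec k a s) (sldSin k a s (dir i)) := by
    obtain ⟨f, hf⟩ := hd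
    rw [hf]
    exact inner_discVec_comm _ _ _
  obtain ⟨L, hL, hLc, hLd⟩ := exists_isSelfAdjoint_apply_eq (cosVec_ne_smul ha s)
    (sinVec_ne_smul hk ha hs) hcc hdd h2
  exact ⟨L, isSLD_of_apply hL hLc hLd, hLc, hLd⟩

theorem exists_isSLD {k a : ℝ} (hk : k ≠ 0) (ha : 0 < a) (s : Separation) (i : Fin 3) :
    ∃ L, IsSLD k a s i L := by
  by_cases hs : s = 0
  · refine ⟨0, IsSelfAdjoint.zero _, ?_⟩
    have h1 : ∀ x, ketbra x 0 = 0 := fun x => by ext1; simp [ketbra]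
    have h2 : ∀ x, ketbra 0 x = 0 := fun x => by ext1; simp [ketbra]
    rw [lineDeriv_rho, hs, cosDeriv_zero, sinVec_zero, h1, h2, h1, h2, zero_mul, mul_zero]
    simp only [add_zero, smul_zero]
  · exact (exists_isSLD_apply hk ha hs i).imp fun L h => h.1

theorem IsSLD.apply_cosVec {k a : ℝ} (hk : k ≠ 0) (ha : 0 < a) {s : Separation} (hs : s ≠ 0)
    {i : Fin 3} {L : Op} (h : IsSLD k a s i L) :
    L (cosVec k a s) = sldCos k a s (dir i) ∧ L (sinVec k a s) = sldSin k a s (dir i) := by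
  obtain ⟨L', hL', hc, hd⟩ := exists_isSLD_apply hk ha hs i
  have := h.apply_eq hL'
  exact ⟨this.1.trans hc, this.2.trans hd⟩

theorem opTrace_rho_mul {k a : ℝ} {T : Op} {s : Separation} {y z : Hilb}
    (hc : ContinuousLinearMap.adjoint T (cosVec k a s) = y)
    (hd : ContinuousLinearMap.adjoint T (sinVec k a s) = z) :
    opTrace (rho k a s * T) = inner ℂ y (cosVec k a s) + inner ℂ z (sinVec k a s) := by
  rw [rho_eq, add_mul, ketbra_mul, ketbra_mul, hc, hd]
  exact opTrace_ketbra_add _ _ _ _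

theorem opTrace_rho_mul_proj {k a : ℝ} {P : Op} (hP : IsStarProjection P) (s : Separation) :
    opTrace (rho k a s * P) = ((‖P (cosVec k a s)‖ ^ 2 + ‖P (sinVec k a s)‖ ^ 2 : ℝ) : ℂ) := by
  have h (x : Hilb) : inner ℂ (P x) x = ((‖P x‖ ^ 2 : ℝ) : ℂ) := by
    have h1 : P (P x) = P x := congrArg (fun T : Op => T x) hP.isIdempotentElem
    rw [← h1, inner_map_comm hP.isSelfAdjoint, h1, inner_self_eq_norm_sq_to_K]
    push_cast
    rfl
  rw [opTrace_rho_mul (congrArg (fun T : Op => T _) hP.isSelfAdjoint.adjoint_eq)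
    (congrArg (fun T : Op => T _) hP.isSelfAdjoint.adjoint_eq), h, h, Complex.ofReal_add]

theorem prob_eq {k a : ℝ} {P : Op} (hP : IsStarProjection P) (s : Separation) :
    prob k a P s = ‖P (cosVec k a s)‖ ^ 2 + ‖P (sinVec k a s)‖ ^ 2 := by
  rw [prob, opTrace_rho_mul_proj hP, Complex.ofReal_re]

/-- Away from `s = 0` the quantum Fisher information matrix does not depend on the choice of the
symmetric logarithmic derivatives. -/
theorem qfim_apply {k a : ℝ} (hk : k ≠ 0) (ha : 0 < a) {L : Separation → Fin 3 → Op}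
    (hL : ∀ s i, IsSLD k a s i (L s i)) {P : Op} (hP : IsSelfAdjoint P) {s : Separation}
    (hs : s ≠ 0) (i j : Fin 3) :
    qfim k a L P s i j = (inner ℂ (P (sldCos k a s (dir i))) (sldCos k a s (dir j)) +
      inner ℂ (P (sldSin k a s (dir i))) (sldSin k a s (dir j))).re := by
  obtain ⟨hci, hdi⟩ := (hL s i).apply_cosVec hk ha hs
  obtain ⟨hcj, hdj⟩ := (hL s j).apply_cosVec hk ha hs
  have hadj : ContinuousLinearMap.adjoint (L s i * P * L s j) = L s j * P * L s i := by
    have := ContinuousLinearMap.star_eq_adjoint (L s i * P * L s j)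
    rw [← this, star_mul, star_mul, (hL s i).1.star_eq, (hL s j).1.star_eq, hP.star_eq, mul_assoc]
  rw [qfim, Matrix.of_apply, mul_assoc, mul_assoc, ← mul_assoc (L s i),
    opTrace_rho_mul (T := L s i * P * L s j) rfl rfl, hadj]
  congr 2
  · change inner ℂ (L s j (P (L s i (cosVec k a s)))) (cosVec k a s) = _
    rw [inner_map_comm (hL s j).1, hci, hcj]
  · change inner ℂ (L s j (P (L s i (sinVec k a s)))) (sinVec k a s) = _
    rw [inner_map_comm (hL s j).1, hdi, hdj]

end State

/-! ### Limits of the Fisher information at `s = 0` -/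

/-- The vector whose projection by `Π` governs the quantum Fisher information at `s = 0`. Up to a
factor `i` it is `∂ᵢ⁰ Φ`. -/
def tangent (k a : ℝ) (i : Fin 3) : Hilb :=
  sinDeriv k a 0 (dir i) + (twist k a 0 (dir i) : ℂ) • cosVec k a 0

theorem dPupilKer_eq (k a : ℝ) (i : Fin 3) : dPupilKer k a i = Complex.I • tangent k a i := by
  have h : inner ℂ (cosVec k a 0) (sinDeriv k a 0 (dir i)) = -(twist k a 0 (dir i) : ℂ) := by
    rw [← inner_twist, cosDeriv_zero, inner_zero_left, zero_sub, neg_neg]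
  rw [dPupilKer, dPupil_eq, pupil_zero, inner_smul_right, h, tangent, smul_add, mul_smul, neg_smul,
    smul_neg, sub_neg_eq_add]

/-- The limit of the quantum Fisher information matrix corresponding to `P`. -/
def limitFisher (k a : ℝ) (P : Op) : Matrix (Fin 3) (Fin 3) ℝ :=
  Matrix.of fun i j => 4 * (inner ℂ (P (tangent k a i)) (tangent k a j)).re

theorem continuous_twist (k a : ℝ) (h : Separation) : Continuous fun s => twist k a s h :=
  (Complex.continuous_re.comp ((continuous_cosDeriv k a h).inner (continuous_sinVec k a))).sub
    (Complex.continuous_re.comp ((continuous_cosVec k a).inner (continuous_sinDeriv k a h)))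

theorem continuous_sldCos (k a : ℝ) (h : Separation) : Continuous fun s => sldCos k a s h :=
  ((continuous_cosDeriv k a h).sub ((Complex.continuous_ofReal.comp (continuous_twist k a h)).smul
    (continuous_sinVec k a))).const_smul (2 : ℂ)

theorem continuous_sldSin (k a : ℝ) (h : Separation) : Continuous fun s => sldSin k a s h :=
  ((continuous_sinDeriv k a h).add ((Complex.continuous_ofReal.comp (continuous_twist k a h)).smul
    (continuous_cosVec k a))).const_smul (2 : ℂ)

theorem sldCos_zero (k a : ℝ) (h : Separation) : sldCos k a 0 h = 0 := by
  rw [sldCos, cosDeriv_zero, sinVec_zero, smul_zero, sub_zero, smul_zero]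

theorem sldSin_zero (k a : ℝ) (i : Fin 3) : sldSin k a 0 (dir i) = (2 : ℂ) • tangent k a i := rfl

theorem tendsto_qfim {k a : ℝ} (hk : k ≠ 0) (ha : 0 < a) {L : Separation → Fin 3 → Op}
    (hL : ∀ s i, IsSLD k a s i (L s i)) {P : Op} (hP : IsSelfAdjoint P) :
    Tendsto (qfim k a L P) (𝓝[≠] 0) (𝓝 (limitFisher k a P)) := by
  refine tendsto_pi_nhds.2 fun i => tendsto_pi_nhds.2 fun j => ?_
  have h1 : Continuous fun s => (inner ℂ (P (sldCos k a s (dir i))) (sldCos k a s (dir j)) +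
      inner ℂ (P (sldSin k a s (dir i))) (sldSin k a s (dir j))).re :=
    Complex.continuous_re.comp
      (((P.continuous.comp (continuous_sldCos k a _)).inner (continuous_sldCos k a _)).add
        ((P.continuous.comp (continuous_sldSin k a _)).inner (continuous_sldSin k a _)))
  have h2 : (inner ℂ (P (sldCos k a 0 (dir i))) (sldCos k a 0 (dir j)) +
      inner ℂ (P (sldSin k a 0 (dir i))) (sldSin k a 0 (dir j))).re = limitFisher k a P i j := by
    rw [sldCos_zero k a (dir j), inner_zero_right, zero_add, sldSin_zero, sldSin_zero, map_smul,
      inner_smul_left, inner_smul_right, limitFisher, Matrix.of_apply, Complex.conj_ofNat,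
      ← mul_assoc]
    norm_num [Complex.mul_re]
  rw [← h2]
  refine ((h1.tendsto 0).mono_left nhdsWithin_le_nhds).congr' ?_
  filter_upwards [self_mem_nhdsWithin] with s hs
  exact (qfim_apply hk ha hL hP hs i j).symm

/-! ### Derivative of the probability -/

theorem hasLineDerivAt_norm_sq {E F : Type*} [NormedAddCommGroup E] [InnerProductSpace ℂ E]
    [NormedAddCommGroup F] [NormedSpace ℝ F] (P : E →L[ℂ] E) {f : F → E} {f' : F →L[ℝ] E} {s : F}
    (hf : HasFDerivAt f f' s) (h : F) :
    HasLineDerivAt ℝ (fun s => ‖P (f s)‖ ^ 2) (2 * (inner ℂ (P (f s)) (P (f' h))).re) s h := by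
  have h1 : HasFDerivAt (fun s => P (f s)) ((P.restrictScalars ℝ).comp f') s :=
    (P.restrictScalars ℝ).hasFDerivAt.comp s hf
  have h2 : HasDerivAt (fun t : ℝ => P (f (s + t • h))) (P (f' h)) 0 := h1.hasLineDerivAt h
  have h3 := h2.inner ℂ h2
  have h4 := (Complex.reCLM.hasFDerivAt.comp_hasDerivAt (0 : ℝ) h3)
  have h5 : (fun t : ℝ => ‖P (f (s + t • h))‖ ^ 2) =
      Complex.reCLM ∘ fun t : ℝ => inner ℂ (P (f (s + t • h))) (P (f (s + t • h))) := by
    ext t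
    exact norm_sq_eq_re_inner (𝕜 := ℂ) _
  rw [HasLineDerivAt, h5]
  convert! h4 using 1
  have : (inner ℂ (P (f' h)) (P (f s))).re = (inner ℂ (P (f s)) (P (f' h))).re :=
    inner_re_symm (𝕜 := ℂ) _ _
  simp only [zero_smul, add_zero, Complex.reCLM_apply, Complex.add_re, this]
  ring

theorem hasLineDerivAt_prob {k a : ℝ} {P : Op} (hP : IsStarProjection P) (s h : Separation) :
    HasLineDerivAt ℝ (prob k a P) (2 * (inner ℂ (P (cosVec k a s)) (P (cosDeriv k a s h))).re +
      2 * (inner ℂ (P (sinVec k a s)) (P (sinDeriv k a s h))).re) s h := by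
  rw [funext (prob_eq hP)]
  exact HasDerivAt.add (hasLineDerivAt_norm_sq P (hasFDerivAt_cosVec k a s) h)
    (hasLineDerivAt_norm_sq P (hasFDerivAt_sinVec k a s) h)

theorem lineDeriv_prob {k a : ℝ} {P : Op} (hP : IsStarProjection P) (s h : Separation) :
    lineDeriv ℝ (prob k a P) s h =
      2 * (inner ℂ (P (cosVec k a s)) (P (cosDeriv k a s h))).re +
        2 * (inner ℂ (P (sinVec k a s)) (P (sinDeriv k a s h))).re :=
  (hasLineDerivAt_prob hP s h).lineDeriv

theorem continuous_prob {k a : ℝ} {P : Op} (hP : IsStarProjection P) :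
    Continuous (prob k a P) := by
  rw [funext (prob_eq hP)]
  exact ((P.continuous.comp (continuous_cosVec k a)).norm.pow 2).add
    ((P.continuous.comp (continuous_sinVec k a)).norm.pow 2)

theorem continuous_lineDeriv_prob {k a : ℝ} {P : Op} (hP : IsStarProjection P) (h : Separation) :
    Continuous fun s => lineDeriv ℝ (prob k a P) s h := by
  rw [funext fun s => lineDeriv_prob hP s h]
  exact ((Complex.continuous_re.comp ((P.continuous.comp (continuous_cosVec k a)).inner
    (P.continuous.comp (continuous_cosDeriv k a h)))).const_mul 2).add
    ((Complex.continuous_re.comp ((P.continuous.comp (continuous_sinVec k a)).inner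
    (P.continuous.comp (continuous_sinDeriv k a h)))).const_mul 2)

theorem lineDeriv_prob_zero {k a : ℝ} {P : Op} (hP : IsStarProjection P) (h : Separation) :
    lineDeriv ℝ (prob k a P) 0 h = 0 := by
  rw [lineDeriv_prob hP, cosDeriv_zero, sinVec_zero, map_zero, inner_zero_right, inner_zero_left,
    Complex.zero_re, mul_zero, add_zero]

theorem prob_zero {k a : ℝ} {P : Op} (hP : IsStarProjection P) :
    prob k a P 0 = ‖P (cosVec k a 0)‖ ^ 2 := by
  rw [prob_eq hP, sinVec_zero, map_zero, norm_zero]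
  ring

theorem nullAtZero_iff {k a : ℝ} {P : Op} (hP : IsStarProjection P) :
    NullAtZero k a P ↔ P (cosVec k a 0) = 0 := by
  rw [NullAtZero, opTrace_rho_mul_proj hP, Complex.ofReal_eq_zero, sinVec_zero, map_zero, norm_zero]
  simp only [ne_eq, OfNat.ofNat_ne_zero, not_false_eq_true, zero_pow, add_zero,
    pow_eq_zero_iff, norm_eq_zero]

theorem regularAtZero_iff {k a : ℝ} {P : Op} (hP : IsStarProjection P) :
    RegularAtZero k a P ↔ P (cosVec k a 0) ≠ 0 := (nullAtZero_iff hP).not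

/-! ### Regular projectors -/

theorem inner_proj_self {E : Type*} [NormedAddCommGroup E] [InnerProductSpace ℂ E]
    [CompleteSpace E] {P : E →L[ℂ] E} (hP : IsStarProjection P) (x y : E) :
    inner ℂ (P x) y = inner ℂ (P x) (P y) := by
  have h1 : P (P x) = P x := congrArg (fun T : E →L[ℂ] E => T x) hP.isIdempotentElem
  rw [← inner_map_comm hP.isSelfAdjoint, h1]

theorem limitFisher_apply {k a : ℝ} {P : Op} (hP : IsStarProjection P) (i j : Fin 3) :
    limitFisher k a P i j = 4 * (inner ℂ (P (tangent k a i)) (P (tangent k a j))).re := by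
  rw [limitFisher, Matrix.of_apply, inner_proj_self hP]

theorem re_inner_self {E : Type*} [NormedAddCommGroup E] [InnerProductSpace ℂ E] (x : E) :
    (inner ℂ x x).re = ‖x‖ ^ 2 := (norm_sq_eq_re_inner (𝕜 := ℂ) x).symm

theorem limitFisher_eq_zero_iff {k a : ℝ} {P : Op} (hP : IsStarProjection P) :
    limitFisher k a P = 0 ↔ ∀ i, P (tangent k a i) = 0 := by
  constructor
  · intro h i
    have h1 := congrFun (congrFun h i) i
    rw [limitFisher_apply hP, re_inner_self, Matrix.zero_apply] at h1
    exact norm_eq_zero.1 (pow_eq_zero_iff two_ne_zero |>.1 (by linarith))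
  · intro h
    ext i j
    rw [limitFisher_apply hP, h, inner_zero_left, Complex.zero_re, mul_zero, Matrix.zero_apply]

/-- The classical Fisher information of a regular projector is stationary at `s = 0`. -/
theorem tendsto_cfim_regular {k a : ℝ} {P : Op} (hP : IsStarProjection P)
    (h : RegularAtZero k a P) : Tendsto (cfim k a P) (𝓝 0) (𝓝 0) := by
  have h0 : prob k a P 0 ≠ 0 := by
    rw [prob_zero hP]
    exact pow_ne_zero 2 (norm_ne_zero_iff.2 ((regularAtZero_iff hP).1 h))
  refine tendsto_pi_nhds.2 fun i => tendsto_pi_nhds.2 fun j => ?_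
  have h1 := (((continuous_lineDeriv_prob (k := k) (a := a) hP (dir i)).tendsto 0).mul
    ((continuous_lineDeriv_prob (k := k) (a := a) hP (dir j)).tendsto 0)).div
    ((continuous_prob hP).tendsto 0) h0
  rw [lineDeriv_prob_zero hP, zero_mul, zero_div] at h1
  exact h1

theorem saturatedRegular_iff {k a : ℝ} (hk : k ≠ 0) (ha : 0 < a) {L : Separation → Fin 3 → Op}
    (hL : ∀ s i, IsSLD k a s i (L s i)) {P : Op} (hP : IsStarProjection P)
    (h : RegularAtZero k a P) :
    SaturatedRegular k a L P ↔ ∀ i, P (tangent k a i) = 0 := by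
  have h1 := (tendsto_cfim_regular hP h).mono_left (nhdsWithin_le_nhds (s := {0}ᶜ))
  have h2 := tendsto_qfim hk ha hL hP.isSelfAdjoint
  rw [← limitFisher_eq_zero_iff hP]
  constructor
  · rintro ⟨J, hq, hc⟩
    rw [tendsto_nhds_unique h2 hq, tendsto_nhds_unique h1 hc]
  · intro h0
    exact ⟨0, h0 ▸ h2, h1⟩

/-! ### Null projectors -/

instance (δ : Separation) : NeBot (alongDir δ) := by
  unfold alongDir
  infer_instance

theorem alongDir_le_nhds (δ : Separation) : alongDir δ ≤ 𝓝 0 := by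
  have h : Tendsto (fun p : ℝ × Separation => p.1 • p.2) (𝓝[>] (0 : ℝ) ×ˢ 𝓝 δ) (𝓝 ((0 : ℝ) • δ)) :=
    (tendsto_fst.mono_right nhdsWithin_le_nhds).smul tendsto_snd
  rwa [zero_smul] at h

theorem tendsto_inv_smul {F G : Type*} [NormedAddCommGroup F] [NormedSpace ℝ F]
    [NormedAddCommGroup G] [NormedSpace ℝ G] {f : F → G} {f' : F →L[ℝ] G}
    (hf : HasFDerivAt f f' 0) (h0 : f 0 = 0) (δ : F) :
    Tendsto (fun p : ℝ × F => p.1⁻¹ • f (p.1 • p.2)) (𝓝[>] (0 : ℝ) ×ˢ 𝓝 δ) (𝓝 (f' δ)) := by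
  have hpos : ∀ᶠ p : ℝ × F in 𝓝[>] (0 : ℝ) ×ˢ 𝓝 δ, 0 < p.1 :=
    tendsto_fst.eventually self_mem_nhdsWithin
  have h := (hf.hasFDerivWithinAt (s := Set.univ)).lim (l := 𝓝[>] (0 : ℝ) ×ˢ 𝓝 δ)
    (c := fun p => p.1⁻¹) (d := fun p => p.1 • p.2) (v := δ) ?_
    (Eventually.of_forall fun _ => Set.mem_univ _) ?_
  · simpa only [zero_add, h0, sub_zero] using h
  · have h1 : Tendsto (fun p : ℝ × F => p.1 • p.2) (𝓝[>] (0 : ℝ) ×ˢ 𝓝 δ) (𝓝 ((0 : ℝ) • δ)) :=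
      (tendsto_fst.mono_right nhdsWithin_le_nhds).smul tendsto_snd
    rwa [zero_smul] at h1
  · refine (tendsto_snd (f := 𝓝[>] (0 : ℝ)) (g := 𝓝 δ)).congr' ?_
    filter_upwards [hpos] with p hp
    rw [inv_smul_smul₀ hp.ne']

section Null

variable {k a : ℝ} {P : Op}

theorem hasFDerivAt_proj (P : Op) {f : Separation → Hilb} {f' : Separation →L[ℝ] Hilb}
    {s : Separation} (hf : HasFDerivAt f f' s) :
    HasFDerivAt (fun s => P (f s)) ((P.restrictScalars ℝ).comp f') s :=
  (P.restrictScalars ℝ).hasFDerivAt.comp s hf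

theorem tendsto_inv_smul_cosVec (h : P (cosVec k a 0) = 0) (δ : Separation) :
    Tendsto (fun p : ℝ × Separation => p.1⁻¹ • P (cosVec k a (p.1 • p.2)))
      (𝓝[>] (0 : ℝ) ×ˢ 𝓝 δ) (𝓝 0) := by
  have h1 := tendsto_inv_smul (hasFDerivAt_proj P (hasFDerivAt_cosVec k a 0)) h δ
  have h2 : (P.restrictScalars ℝ).comp (cosDeriv k a 0) δ = 0 := by
    change P (cosDeriv k a 0 δ) = 0
    rw [cosDeriv_zero, map_zero]
  rwa [h2] at h1

theorem tendsto_inv_smul_sinVec (P : Op) (δ : Separation) :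
    Tendsto (fun p : ℝ × Separation => p.1⁻¹ • P (sinVec k a (p.1 • p.2)))
      (𝓝[>] (0 : ℝ) ×ˢ 𝓝 δ) (𝓝 (P (sinDeriv k a 0 δ))) :=
  tendsto_inv_smul (hasFDerivAt_proj P (hasFDerivAt_sinVec k a 0))
    (by rw [sinVec_zero, map_zero]) δ

/-- The leading term of the probability of a null projector is quadratic. -/
theorem tendsto_prob_div_sq (hP : IsStarProjection P) (h : P (cosVec k a 0) = 0)
    (δ : Separation) :
    Tendsto (fun p : ℝ × Separation => prob k a P (p.1 • p.2) / p.1 ^ 2)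
      (𝓝[>] (0 : ℝ) ×ˢ 𝓝 δ) (𝓝 (‖P (sinDeriv k a 0 δ)‖ ^ 2)) := by
  have h1 := ((tendsto_inv_smul_cosVec h δ).norm.pow 2).add
    ((tendsto_inv_smul_sinVec (k := k) (a := a) P δ).norm.pow 2)
  rw [norm_zero, zero_pow two_ne_zero, zero_add] at h1
  refine h1.congr fun p => ?_
  rw [prob_eq hP, norm_smul, norm_smul, mul_pow, mul_pow, ← mul_add, norm_inv, inv_pow,
    Real.norm_eq_abs, sq_abs, inv_mul_eq_div]

theorem tendsto_lineDeriv_prob_div (hP : IsStarProjection P) (h : P (cosVec k a 0) = 0)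
    (δ e : Separation) :
    Tendsto (fun p : ℝ × Separation => lineDeriv ℝ (prob k a P) (p.1 • p.2) e / p.1)
      (𝓝[>] (0 : ℝ) ×ˢ 𝓝 δ)
      (𝓝 (2 * (inner ℂ (P (sinDeriv k a 0 δ)) (P (sinDeriv k a 0 e))).re)) := by
  have hs : Tendsto (fun p : ℝ × Separation => p.1 • p.2) (𝓝[>] (0 : ℝ) ×ˢ 𝓝 δ) (𝓝 0) :=
    alongDir_le_nhds δ
  have hc' : Tendsto (fun p : ℝ × Separation => P (cosDeriv k a (p.1 • p.2) e))
      (𝓝[>] (0 : ℝ) ×ˢ 𝓝 δ) (𝓝 (P (cosDeriv k a 0 e))) :=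
    ((P.continuous.comp (continuous_cosDeriv k a e)).tendsto 0).comp hs
  have hd' : Tendsto (fun p : ℝ × Separation => P (sinDeriv k a (p.1 • p.2) e))
      (𝓝[>] (0 : ℝ) ×ˢ 𝓝 δ) (𝓝 (P (sinDeriv k a 0 e))) :=
    ((P.continuous.comp (continuous_sinDeriv k a e)).tendsto 0).comp hs
  have h1 := ((Complex.continuous_re.tendsto _).comp
      ((tendsto_inv_smul_cosVec h δ).inner hc')).const_mul 2 |>.add
    (((Complex.continuous_re.tendsto _).comp
      ((tendsto_inv_smul_sinVec (k := k) (a := a) P δ).inner hd')).const_mul 2)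
  rw [inner_zero_left, Complex.zero_re, mul_zero, zero_add] at h1
  refine h1.congr fun p => ?_
  have hre : ∀ x y : Hilb, (inner ℂ (p.1⁻¹ • x) y).re = p.1⁻¹ * (inner ℂ x y).re := fun x y => by
    change (inner ℂ (((p.1⁻¹ : ℝ) : ℂ) • x) y).re = _
    rw [inner_smul_left, Complex.conj_ofReal, Complex.re_ofReal_mul]
  simp only [Function.comp_apply, hre]
  rw [lineDeriv_prob hP]
  ring

/-- The classical Fisher information of a null projector along a direction in which its second-order
quotient is defined. -/
theorem tendsto_cfim_null (hP : IsStarProjection P) (h : P (cosVec k a 0) = 0) {δ : Separation}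
    (hδ : P (sinDeriv k a 0 δ) ≠ 0) (i j : Fin 3) :
    Tendsto (fun s => cfim k a P s i j) (alongDir δ)
      (𝓝 (2 * (inner ℂ (P (sinDeriv k a 0 δ)) (P (sinDeriv k a 0 (dir i)))).re *
        (2 * (inner ℂ (P (sinDeriv k a 0 δ)) (P (sinDeriv k a 0 (dir j)))).re) /
        ‖P (sinDeriv k a 0 δ)‖ ^ 2)) := by
  have h1 := ((tendsto_lineDeriv_prob_div hP h δ (dir i)).mul
    (tendsto_lineDeriv_prob_div hP h δ (dir j))).div (tendsto_prob_div_sq hP h δ)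
    (pow_ne_zero 2 (norm_ne_zero_iff.2 hδ))
  refine tendsto_map'_iff.2 (h1.congr' ?_)
  have hpos : ∀ᶠ p : ℝ × Separation in 𝓝[>] (0 : ℝ) ×ˢ 𝓝 δ, 0 < p.1 :=
    tendsto_fst.eventually self_mem_nhdsWithin
  filter_upwards [hpos] with p hp
  simp only [Pi.div_apply, Function.comp_apply, cfim, Matrix.of_apply]
  rw [div_mul_div_comm, ← sq, div_div_div_cancel_right₀ (pow_ne_zero 2 hp.ne')]

theorem nondegenerate_iff (hP : IsStarProjection P) (h : P (cosVec k a 0) = 0) (δ : Separation) :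
    Nondegenerate k a P δ ↔ P (sinDeriv k a 0 δ) ≠ 0 := by
  refine not_congr ?_
  have h1 : Tendsto (fun t : ℝ => (t, δ)) (𝓝[>] 0) (𝓝[>] (0 : ℝ) ×ˢ 𝓝 δ) :=
    tendsto_id.prodMk tendsto_const_nhds
  have h2 := (tendsto_prob_div_sq hP h δ).comp h1
  rw [Asymptotics.isLittleO_iff_tendsto' (by
    filter_upwards [self_mem_nhdsWithin] with t ht h0
    exact absurd h0 (pow_ne_zero 2 (ne_of_gt ht)))]
  constructor
  · intro h3
    have := tendsto_nhds_unique h2 h3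
    simpa using this
  · intro h3
    rw [h3, norm_zero, zero_pow two_ne_zero] at h2
    exact h2

/-- The Cauchy–Schwarz bound on the classical Fisher information. -/
theorem abs_cfim_le (hP : IsStarProjection P) (s : Separation) (i j : Fin 3) :
    |cfim k a P s i j| ≤ 4 * (‖P (cosDeriv k a s (dir i))‖ + ‖P (sinDeriv k a s (dir i))‖) *
      (‖P (cosDeriv k a s (dir j))‖ + ‖P (sinDeriv k a s (dir j))‖) := by
  have hp := prob_eq (k := k) (a := a) hP s
  have hp0 : 0 ≤ prob k a P s := by rw [hp]; positivity
  have hd (i : Fin 3) : |lineDeriv ℝ (prob k a P) s (dir i)| ≤ Real.sqrt (prob k a P s) *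
      (2 * (‖P (cosDeriv k a s (dir i))‖ + ‖P (sinDeriv k a s (dir i))‖)) := by
    have hre : ∀ x y : Hilb, |(inner ℂ x y).re| ≤ ‖x‖ * ‖y‖ := fun x y =>
      (Complex.abs_re_le_norm _).trans (norm_inner_le_norm x y)
    have h1 : ‖P (cosVec k a s)‖ ≤ Real.sqrt (prob k a P s) :=
      Real.le_sqrt_of_sq_le (by rw [hp]; linarith [sq_nonneg ‖P (sinVec k a s)‖])
    have h2 : ‖P (sinVec k a s)‖ ≤ Real.sqrt (prob k a P s) :=
      Real.le_sqrt_of_sq_le (by rw [hp]; linarith [sq_nonneg ‖P (cosVec k a s)‖])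
    rw [lineDeriv_prob hP, ← mul_add, abs_mul, abs_two, mul_left_comm, mul_add]
    refine mul_le_mul_of_nonneg_left ((abs_add_le _ _).trans (add_le_add ?_ ?_)) two_pos.le
    · exact (hre _ _).trans (mul_le_mul_of_nonneg_right h1 (norm_nonneg _))
    · exact (hre _ _).trans (mul_le_mul_of_nonneg_right h2 (norm_nonneg _))
  rw [cfim, Matrix.of_apply, abs_div, abs_mul, abs_of_nonneg hp0]
  refine div_le_of_le_mul₀ hp0 (by positivity) ?_
  refine (mul_le_mul (hd i) (hd j) (abs_nonneg _) (by positivity)).trans (le_of_eq ?_)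
  nth_rewrite 3 [← Real.mul_self_sqrt hp0]
  ring

theorem tendsto_cfim_zero (hP : IsStarProjection P)
    (h : ∀ i, P (sinDeriv k a 0 (dir i)) = 0) : Tendsto (cfim k a P) (𝓝 0) (𝓝 0) := by
  refine tendsto_pi_nhds.2 fun i => tendsto_pi_nhds.2 fun j => ?_
  have hg (i : Fin 3) : Tendsto (fun s => ‖P (cosDeriv k a s (dir i))‖ +
      ‖P (sinDeriv k a s (dir i))‖) (𝓝 0) (𝓝 0) := by
    have := ((P.continuous.comp (continuous_cosDeriv k a (dir i))).norm.tendsto 0).add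
      ((P.continuous.comp (continuous_sinDeriv k a (dir i))).norm.tendsto 0)
    simpa only [Function.comp_apply, cosDeriv_zero, h, map_zero, norm_zero, add_zero] using this
  have h1 := ((hg i).const_mul 4).mul (hg j)
  rw [mul_zero] at h1
  exact squeeze_zero_norm (fun s => abs_cfim_le hP s i j) h1

theorem proj_tangent (h : P (cosVec k a 0) = 0) (i : Fin 3) :
    P (tangent k a i) = P (sinDeriv k a 0 (dir i)) := by
  rw [tangent, map_add, map_smul, h, smul_zero, add_zero]

theorem eq_smul_of_inner_sq {E : Type*} [NormedAddCommGroup E] [InnerProductSpace ℂ E] {x y : E}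
    (hx : x ≠ 0) (h : (inner ℂ x y).re ^ 2 = ‖x‖ ^ 2 * ‖y‖ ^ 2) : ∃ η : ℝ, y = (η : ℂ) • x := by
  refine ⟨(inner ℂ x y).re / ‖x‖ ^ 2, sub_eq_zero.1 ?_⟩
  have hx' : ‖x‖ ^ 2 ≠ 0 := by simpa using hx
  set η := (inner ℂ x y).re / ‖x‖ ^ 2
  have h1 : η * ‖x‖ ^ 2 = (inner ℂ x y).re := div_mul_cancel₀ _ hx'
  have h2 : (inner ℂ y x).re = (inner ℂ x y).re := inner_re_symm (𝕜 := ℂ) _ _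
  have h3 : ‖y - (η : ℂ) • x‖ ^ 2 = ‖y‖ ^ 2 - 2 * η * (inner ℂ x y).re + η ^ 2 * ‖x‖ ^ 2 := by
    rw [← re_inner_self, inner_sub_left, inner_sub_right, inner_sub_right, inner_smul_left,
      inner_smul_left, inner_smul_right, inner_smul_right, Complex.conj_ofReal]
    simp only [Complex.sub_re, Complex.re_ofReal_mul, h2, re_inner_self]
    ring
  have h4 : ‖y - (η : ℂ) • x‖ ^ 2 * ‖x‖ ^ 2 = 0 := by
    rw [h3]
    linear_combination (-1) * h + (η * ‖x‖ ^ 2 - (inner ℂ x y).re) * h1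
  exact norm_eq_zero.1 (pow_eq_zero_iff two_ne_zero |>.1 ((mul_eq_zero.1 h4).resolve_right hx'))

/-- Pairwise real-proportional vectors are real multiples of one vector. -/
theorem exists_eq_smul_of_pairwise {ι E : Type*} [AddCommGroup E] [Module ℂ E] {w : ι → E}
    (h : ∀ i j, (∃ η : ℝ, w i = (η : ℂ) • w j) ∨ ∃ η : ℝ, w j = (η : ℂ) • w i) :
    ∃ (u : E) (c : ι → ℝ), ∀ i, w i = (c i : ℂ) • u := by
  by_cases h0 : ∀ i, w i = 0
  · exact ⟨0, 0, fun i => by rw [h0 i, smul_zero]⟩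
  · push Not at h0
    obtain ⟨i₀, hi₀⟩ := h0
    have h1 : ∀ i, ∃ c : ℝ, w i = (c : ℂ) • w i₀ := fun i => by
      rcases h i i₀ with h1 | ⟨η, hη⟩
      · exact h1
      · have hη0 : (η : ℂ) ≠ 0 := fun h2 => hi₀ (by rw [hη, h2, zero_smul])
        exact ⟨η⁻¹, by rw [hη, Complex.ofReal_inv, inv_smul_smul₀ hη0]⟩
    choose c hc using h1
    exact ⟨w i₀, c, hc⟩

theorem sinDeriv_eq_sum (k a : ℝ) (s δ : Separation) :
    sinDeriv k a s δ = ∑ i, (δ i : ℂ) • sinDeriv k a s (dir i) := by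
  have h : δ = ∑ i, δ i • dir i := by
    ext j
    simp [Finset.sum_apply, Pi.single_apply]
  conv_lhs => rw [h, map_sum]
  exact Finset.sum_congr rfl fun i _ => map_smul _ _ _

theorem saturatedNull_iff (hk : k ≠ 0) (ha : 0 < a) {L : Separation → Fin 3 → Op}
    (hL : ∀ s i, IsSLD k a s i (L s i)) (hP : IsStarProjection P)
    (h : NullAtZero k a P) :
    SaturatedNull k a L P ↔ ∀ i j,
      (∃ η : ℝ, P (sinDeriv k a 0 (dir i)) = (η : ℂ) • P (sinDeriv k a 0 (dir j))) ∨
      ∃ η : ℝ, P (sinDeriv k a 0 (dir j)) = (η : ℂ) • P (sinDeriv k a 0 (dir i)) := by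
  rw [nullAtZero_iff hP] at h
  have hq := tendsto_qfim hk ha hL hP.isSelfAdjoint
  have hJ (i j : Fin 3) : limitFisher k a P i j =
      4 * (inner ℂ (P (sinDeriv k a 0 (dir i))) (P (sinDeriv k a 0 (dir j)))).re := by
    rw [limitFisher_apply hP, proj_tangent h, proj_tangent h]
  constructor
  · rintro ⟨J, hJq, hc⟩ i j
    have hJ' : J = limitFisher k a P := tendsto_nhds_unique hJq hq
    by_cases hi : P (sinDeriv k a 0 (dir i)) = 0
    · exact Or.inl ⟨0, by rw [hi, Complex.ofReal_zero, zero_smul]⟩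
    · refine Or.inr (eq_smul_of_inner_sq hi ?_)
      have h1 := hc (dir i) (Or.inl ((nondegenerate_iff hP h _).2 hi))
      have h2 := tendsto_nhds_unique (tendsto_cfim_null hP h hi j j)
        (tendsto_pi_nhds.1 (tendsto_pi_nhds.1 h1 j) j)
      rw [hJ', hJ, re_inner_self, div_eq_iff (pow_ne_zero 2 (norm_ne_zero_iff.2 hi))] at h2
      linarith
  · intro hw
    refine ⟨limitFisher k a P, hq, fun δ hδ => ?_⟩
    by_cases hz : ∀ i, P (sinDeriv k a 0 (dir i)) = 0
    · have : limitFisher k a P = 0 := (limitFisher_eq_zero_iff hP).2 fun i => by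
        rw [proj_tangent h, hz]
      rw [this]
      exact (tendsto_cfim_zero hP hz).mono_left (alongDir_le_nhds δ)
    have hnd : P (sinDeriv k a 0 δ) ≠ 0 := by
      rcases hδ with hδ | hδ
      · exact (nondegenerate_iff hP h δ).1 hδ
      · refine absurd (fun i => ?_) hz
        rw [← proj_tangent h]
        exact (limitFisher_eq_zero_iff hP).1 hδ i
    obtain ⟨u, c, hc⟩ := exists_eq_smul_of_pairwise hw
    obtain ⟨μ, hμ⟩ : ∃ μ : ℝ, P (sinDeriv k a 0 δ) = (μ : ℂ) • u := by
      refine ⟨∑ i, δ i * c i, ?_⟩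
      rw [sinDeriv_eq_sum, map_sum]
      simp only [map_smul, hc, smul_smul, ← Finset.sum_smul, Complex.ofReal_sum,
        Complex.ofReal_mul]
    have hin (b b' : ℝ) : (inner ℂ ((b : ℂ) • u) ((b' : ℂ) • u)).re = b * b' * ‖u‖ ^ 2 := by
      rw [inner_smul_left, inner_smul_right, Complex.conj_ofReal, Complex.re_ofReal_mul,
        Complex.re_ofReal_mul, re_inner_self, mul_assoc]
    have hu : ‖u‖ ^ 2 ≠ 0 := fun h0 => hnd (by
      rw [hμ, norm_eq_zero.1 (pow_eq_zero_iff two_ne_zero |>.1 h0), smul_zero])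
    have hμ0 : μ ≠ 0 := fun h0 => hnd (by rw [hμ, h0, Complex.ofReal_zero, zero_smul])
    refine tendsto_pi_nhds.2 fun i => tendsto_pi_nhds.2 fun j => ?_
    have h1 := tendsto_cfim_null hP h hnd i j
    rw [← re_inner_self, hμ, hc i, hc j, hin, hin, hin] at h1
    rw [hJ, hc i, hc j, hin]
    convert! h1 using 2
    field_simp
    ring

end Null

/-! ### Projectors onto closed spans -/

theorem isStarProjection_projOn (S : Set Hilb) : IsStarProjection (projOn S) :=
  isStarProjection_starProjection

theorem projOn_apply_eq_zero_iff {S : Set Hilb} {x : Hilb} :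
    projOn S x = 0 ↔ ∀ f ∈ S, inner ℂ f x = 0 := by
  rw [projOn, Submodule.starProjection_apply_eq_zero_iff, Submodule.orthogonal_closure,
    Submodule.mem_orthogonal]
  refine ⟨fun h f hf => h f (Submodule.subset_span hf), fun h u hu => ?_⟩
  induction hu using Submodule.span_induction with
  | mem f hf => exact h f hf
  | zero => exact inner_zero_left _
  | add f g _ _ hf hg => rw [inner_add_left, hf, hg, add_zero]
  | smul c f _ hf => rw [inner_smul_left, hf, mul_zero]

theorem projOn_apply_of_mem {S : Set Hilb} {x : Hilb} (hx : x ∈ S) : projOn S x = x :=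
  Submodule.starProjection_eq_self_iff.2
    (Submodule.le_topologicalClosure _ (Submodule.subset_span hx))

theorem projOn_mul_projOn_eq_zero {S T : Set Hilb} (h : ∀ f ∈ S, ∀ g ∈ T, inner ℂ f g = 0) :
    projOn S * projOn T = 0 := by
  refine Submodule.starProjection_comp_starProjection_eq_zero_iff.2 ?_
  rw [Submodule.isOrtho_iff_le, Submodule.orthogonal_closure]
  refine Submodule.topologicalClosure_minimal _ ?_ (Submodule.isClosed_orthogonal _)
  exact Submodule.isOrtho_iff_le.1 (Submodule.isOrtho_span.2 fun f hf g hg => h f hf g hg)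

/-- Projectors with mutually orthogonal ranges add up to `1` if nothing is orthogonal to all of
their ranges. -/
theorem sum_projOn_eq_one {ι : Type*} [Fintype ι] [DecidableEq ι] {S : ι → Set Hilb}
    (horth : ∀ i j, i ≠ j → ∀ f ∈ S i, ∀ g ∈ S j, inner ℂ f g = 0)
    (htotal : ∀ x : Hilb, (∀ i, ∀ f ∈ S i, inner ℂ f x = 0) → x = 0) :
    ∑ i, projOn (S i) = 1 := by
  refine ContinuousLinearMap.ext fun x => (sub_eq_zero.1 (htotal _ fun i f hf => ?_)).symm
  have h1 : ∀ j, projOn (S i) (projOn (S j) x) = if j = i then projOn (S i) x else 0 := fun j => by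
    split_ifs with hj
    · rw [hj]
      exact congrArg (fun T : Op => T x) (isStarProjection_projOn (S i)).isIdempotentElem
    · exact congrArg (fun T : Op => T x) (projOn_mul_projOn_eq_zero (horth i j (Ne.symm hj)))
  refine projOn_apply_eq_zero_iff.1 ?_ f hf
  rw [map_sub, _root_.sum_apply, map_sum, Finset.sum_congr rfl fun j _ => h1 j,
    Finset.sum_ite_eq' Finset.univ i, if_pos (Finset.mem_univ i)]
  exact sub_self _

theorem saturatedRegular_projOn_iff {k a : ℝ} (hk : k ≠ 0) (ha : 0 < a)
    {L : Separation → Fin 3 → Op} (hL : ∀ s i, IsSLD k a s i (L s i)) {S : Set Hilb}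
    (h : RegularAtZero k a (projOn S)) :
    SaturatedRegular k a L (projOn S) ↔ ∀ i, ∀ f ∈ S, inner ℂ (dPupilKer k a i) f = 0 := by
  rw [saturatedRegular_iff hk ha hL (isStarProjection_projOn S) h]
  refine forall_congr' fun i => projOn_apply_eq_zero_iff.trans (forall₂_congr fun f _ => ?_)
  rw [dPupilKer_eq, inner_smul_left, Complex.conj_I, mul_eq_zero,
    or_iff_right (neg_ne_zero.2 Complex.I_ne_zero), inner_eq_zero_symm]

theorem projOn_sinDeriv_eq_smul_iff {k a : ℝ} {S : Set Hilb} {i j : Fin 3} {η : ℝ} :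
    projOn S (sinDeriv k a 0 (dir i)) = (η : ℂ) • projOn S (sinDeriv k a 0 (dir j)) ↔
      ∀ f ∈ S, inner ℂ (dPupil k a i) f = (η : ℂ) * inner ℂ (dPupil k a j) f := by
  rw [← sub_eq_zero, ← map_smul, ← map_sub, projOn_apply_eq_zero_iff]
  refine forall₂_congr fun f _ => ?_
  rw [inner_eq_zero_symm, inner_sub_left, sub_eq_zero, inner_smul_left, Complex.conj_ofReal,
    dPupil_eq, dPupil_eq, inner_smul_left, inner_smul_left, mul_left_comm]
  exact (mul_right_injective₀ (by simp : (starRingEnd ℂ) Complex.I ≠ 0)).eq_iff.symm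

theorem saturatedNull_projOn_iff {k a : ℝ} (hk : k ≠ 0) (ha : 0 < a)
    {L : Separation → Fin 3 → Op} (hL : ∀ s i, IsSLD k a s i (L s i)) {S : Set Hilb}
    (h : NullAtZero k a (projOn S)) :
    SaturatedNull k a L (projOn S) ↔ ∀ i j,
      (∃ η : ℝ, ∀ f ∈ S, inner ℂ (dPupil k a i) f = (η : ℂ) * inner ℂ (dPupil k a j) f) ∨
      ∃ η : ℝ, ∀ f ∈ S, inner ℂ (dPupil k a j) f = (η : ℂ) * inner ℂ (dPupil k a i) f := by
  rw [saturatedNull_iff hk ha hL (isStarProjection_projOn S) h]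
  simp only [projOn_sinDeriv_eq_smul_iff]

/-! ### Radial orthogonality -/

/-- The coefficient of `t ^ (m + 2 N - 2 j)` in the radial polynomial `R_n^m`, `n = m + 2 N`. -/
def radialCoeff (m N j : ℕ) : ℝ :=
  (-1 : ℝ) ^ j * ((m + 2 * N - j).factorial : ℝ) /
    ((j.factorial : ℝ) * ((m + N - j).factorial : ℝ) * ((N - j).factorial : ℝ))

theorem zernikeRadial_eq (m N : ℕ) (t : ℝ) :
    zernikeRadial (m + 2 * N) m t =
      ∑ j ∈ Finset.range (N + 1), radialCoeff m N j * t ^ (m + 2 * N - 2 * j) := by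
  have h1 : (m + 2 * N - m) / 2 = N := by omega
  have h2 : (m + 2 * N + m) / 2 = m + N := by omega
  rw [zernikeRadial, h1, h2]
  rfl

theorem prod_range_natCast_sub {n K : ℕ} (h : K ≤ n) :
    ∏ l ∈ Finset.range K, ((n : ℝ) - l) = n.descFactorial K := by
  rw [Nat.descFactorial_eq_prod_range, Nat.cast_prod]
  refine Finset.prod_congr rfl fun l hl => ?_
  rw [Nat.cast_sub ((Finset.mem_range.1 hl).le.trans h)]

theorem prod_range_erase_sub {N j : ℕ} (hj : j ≤ N) :
    ∏ l ∈ (Finset.range (N + 1)).erase j, ((j : ℝ) - l) =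
      (-1) ^ (N - j) * (j.factorial * (N - j).factorial) := by
  obtain ⟨M, rfl⟩ := Nat.exists_eq_add_of_le hj
  rw [Nat.add_sub_cancel_left]
  induction M with
  | zero =>
    rw [add_zero, Finset.range_add_one, Finset.erase_insert (by simp)]
    simp [prod_range_natCast_sub le_rfl, Nat.descFactorial_self]
  | succ M ih =>
    rw [← add_assoc, Finset.range_add_one, Finset.erase_insert_of_ne (by omega),
      Finset.prod_insert (by simp), ih (by omega), Nat.factorial_succ]
    push_cast
    ring

/-- The partial fraction expansion of `f(x) / ∏ (x - j)`, by Lagrange interpolation at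
`0, …, N`. -/
theorem sum_div_sub_eq (N : ℕ) {f : Polynomial ℝ} (hf : f.degree ≤ N) {x : ℝ} (hx : (N : ℝ) < x) :
    ∑ j ∈ Finset.range (N + 1), (-1) ^ j * f.eval (j : ℝ) /
        (j.factorial * (N - j).factorial * (x - j)) =
      (-1) ^ N * f.eval x / ∏ j ∈ Finset.range (N + 1), (x - j) := by
  have hinj : Set.InjOn (fun j : ℕ => (j : ℝ)) (Finset.range (N + 1)) :=
    Nat.cast_injective.injOn
  have hne : ∀ j ∈ Finset.range (N + 1), x ≠ (j : ℝ) := fun j hj h => by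
    have : (j : ℝ) ≤ N := by exact_mod_cast Nat.lt_succ_iff.1 (Finset.mem_range.1 hj)
    linarith
  have h1 := Lagrange.eq_interpolate_of_eval_eq (s := Finset.range (N + 1))
    (v := fun j : ℕ => (j : ℝ)) (f := f) (fun j : ℕ => f.eval (j : ℝ)) hinj
    (by
      rw [Finset.card_range]
      exact hf.trans_lt (by exact_mod_cast Nat.lt_succ_self N)) (fun _ _ => rfl)
  have h2 := Lagrange.eval_interpolate_not_at_node (fun j : ℕ => f.eval (j : ℝ)) hne
  rw [← h1, Lagrange.eval_nodal] at h2
  have hprod : ∏ j ∈ Finset.range (N + 1), (x - (j : ℝ)) ≠ 0 :=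
    Finset.prod_ne_zero_iff.2 fun j hj => sub_ne_zero.2 (hne j hj)
  rw [eq_div_iff hprod, h2, mul_left_comm, mul_comm]
  congr 1
  rw [Finset.mul_sum]
  refine Finset.sum_congr rfl fun j hj => ?_
  have hj' : j ≤ N := Nat.lt_succ_iff.1 (Finset.mem_range.1 hj)
  have hs : ((-1 : ℝ) ^ (N - j))⁻¹ * (-1) ^ N = (-1) ^ j := by
    obtain ⟨M, rfl⟩ := Nat.exists_eq_add_of_le hj'
    rw [Nat.add_sub_cancel_left, pow_add, mul_comm, mul_assoc,
      mul_inv_cancel₀ (pow_ne_zero _ (by norm_num)), mul_one]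
  rw [Lagrange.nodalWeight, Finset.prod_inv_distrib, prod_range_erase_sub hj', mul_inv, ← hs]
  field_simp

/-- The moments of `R_n^m` against `t ^ (m + 2 i)`, `i ≤ N`: all but the last vanish. -/
theorem sum_radialCoeff_div (m N i : ℕ) (hi : i ≤ N) :
    ∑ j ∈ Finset.range (N + 1), radialCoeff m N j / ((m : ℝ) + N + 1 + i - j) =
      if i = N then ((m + N).factorial * N.factorial / (m + 2 * N + 1).factorial : ℝ) else 0 := by
  set f : Polynomial ℝ :=
    ∏ l ∈ Finset.range N, (Polynomial.C ((m : ℝ) + N + 1 + l) - Polynomial.X)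
  have hdeg : f.degree ≤ N := by
    refine (Polynomial.degree_prod_le _ _).trans ?_
    refine (Finset.sum_le_card_nsmul _ _ 1 fun l _ => ?_).trans (by simp)
    exact (Polynomial.degree_sub_le _ _).trans
      (max_le (Polynomial.degree_C_le.trans zero_le_one) Polynomial.degree_X_le)
  have hev (x : ℝ) : f.eval x = ∏ l ∈ Finset.range N, ((m : ℝ) + N + 1 + l - x) := by
    simp [f, Polynomial.eval_prod]
  have hasc (M K : ℕ) : ((M.factorial : ℝ)) * ∏ l ∈ Finset.range K, ((M : ℝ) + 1 + l) =
      (M + K).factorial := by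
    rw [← Nat.factorial_mul_ascFactorial, Nat.ascFactorial_eq_prod_range]
    push_cast
    rfl
  have hx : (N : ℝ) < (m : ℝ) + N + 1 + i := by
    have : (0 : ℝ) ≤ m := m.cast_nonneg
    have : (0 : ℝ) ≤ i := i.cast_nonneg
    linarith
  have h1 := sum_div_sub_eq N hdeg hx
  have h2 : ∀ j ∈ Finset.range (N + 1), radialCoeff m N j / ((m : ℝ) + N + 1 + i - j) =
      (-1) ^ j * f.eval (j : ℝ) / (j.factorial * (N - j).factorial * ((m : ℝ) + N + 1 + i - j)) :=
    fun j hj => by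
      have hj' : j ≤ N := Nat.lt_succ_iff.1 (Finset.mem_range.1 hj)
      have h3 := hasc (m + N - j) N
      have h4 : m + N - j + N = m + 2 * N - j := by omega
      have h5 : ∏ l ∈ Finset.range N, (((m + N - j : ℕ) : ℝ) + 1 + l) = f.eval (j : ℝ) := by
        rw [hev]
        refine Finset.prod_congr rfl fun l _ => ?_
        rw [Nat.cast_sub (by omega)]
        push_cast
        ring
      rw [h4, h5] at h3
      rw [radialCoeff, ← h3]
      have : ((m + N - j).factorial : ℝ) ≠ 0 := by positivity
      field_simp
  rw [Finset.sum_congr rfl h2, h1, hev]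
  split_ifs with h
  · subst h
    have h3 : ∏ l ∈ Finset.range i, ((m : ℝ) + i + 1 + l - (m + i + 1 + i)) =
        (-1) ^ i * i.factorial := by
      have h4 : ∀ l ∈ Finset.range i,
          ((m : ℝ) + i + 1 + l - (m + i + 1 + i)) = -1 * ((i : ℝ) - l) :=
        fun l _ => by ring
      rw [Finset.prod_congr rfl h4, Finset.prod_mul_distrib, Finset.prod_const, Finset.card_range,
        prod_range_natCast_sub le_rfl, Nat.descFactorial_self]
    have h4 : ∏ j ∈ Finset.range (i + 1), ((m : ℝ) + i + 1 + i - j) =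
        (m + 2 * i + 1).descFactorial (i + 1) := by
      rw [← prod_range_natCast_sub (by omega)]
      refine Finset.prod_congr rfl fun j _ => ?_
      push_cast
      ring
    have h5 : ((m + i).factorial : ℝ) * (m + 2 * i + 1).descFactorial (i + 1) =
        (m + 2 * i + 1).factorial := by
      have := Nat.factorial_mul_descFactorial (show i + 1 ≤ m + 2 * i + 1 by omega)
      rw [show m + 2 * i + 1 - (i + 1) = m + i by omega] at this
      exact_mod_cast this
    have h6 : ((m + 2 * i + 1).descFactorial (i + 1) : ℝ) ≠ 0 := by
      intro h0
      rw [h0, mul_zero] at h5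
      exact (Nat.cast_ne_zero.2 (Nat.factorial_ne_zero _)) h5.symm
    have h7 : ((m + i).factorial : ℝ) ≠ 0 := by positivity
    rw [h3, h4, ← h5, ← mul_assoc, ← mul_pow, neg_one_mul, neg_neg, one_pow, one_mul]
    field_simp
  · rw [Finset.prod_eq_zero (Finset.mem_range.2 (lt_of_le_of_ne hi h)) (by ring), mul_zero,
      zero_div]

theorem zernikeRadial_eq' (m N : ℕ) (t : ℝ) :
    zernikeRadial (m + 2 * N) m t =
      ∑ j ∈ Finset.range (N + 1), radialCoeff m N j * t ^ (m + 2 * (N - j)) := by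
  rw [zernikeRadial_eq]
  refine Finset.sum_congr rfl fun j hj => ?_
  have := Finset.mem_range.1 hj
  rw [show m + 2 * N - 2 * j = m + 2 * (N - j) by omega]

theorem continuous_zernikeRadial (n m : ℕ) : Continuous (zernikeRadial n m) := by
  unfold zernikeRadial
  fun_prop

theorem integral_zernikeRadial_mul_pow (m N i : ℕ) (hi : i ≤ N) :
    ∫ t in (0 : ℝ)..1, zernikeRadial (m + 2 * N) m t * t ^ (m + 2 * i) * t =
      if i = N then ((m + N).factorial * N.factorial / (m + 2 * N + 1).factorial / 2 : ℝ)
      else 0 := by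
  have h1 : ∀ t : ℝ, zernikeRadial (m + 2 * N) m t * t ^ (m + 2 * i) * t =
      ∑ j ∈ Finset.range (N + 1), radialCoeff m N j * t ^ (m + 2 * (N - j) + (m + 2 * i) + 1) :=
    fun t => by
      rw [zernikeRadial_eq', Finset.sum_mul, Finset.sum_mul]
      refine Finset.sum_congr rfl fun j _ => ?_
      ring
  simp only [h1]
  rw [intervalIntegral.integral_finsetSum fun j _ =>
    (by fun_prop : Continuous _).intervalIntegrable 0 1]
  have h2 := sum_radialCoeff_div m N i hi
  have h3 : (if i = N then ((m + N).factorial * N.factorial / (m + 2 * N + 1).factorial / 2 : ℝ)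
      else 0) = (if i = N then ((m + N).factorial * N.factorial / (m + 2 * N + 1).factorial : ℝ)
      else 0) / 2 := by split_ifs <;> simp
  rw [h3, ← h2, Finset.sum_div]
  refine Finset.sum_congr rfl fun j hj => ?_
  have hj' : j ≤ N := Nat.lt_succ_iff.1 (Finset.mem_range.1 hj)
  rw [intervalIntegral.integral_const_mul, integral_pow, one_pow, zero_pow (by omega), sub_zero,
    div_div, mul_one_div]
  congr 1
  push_cast [Nat.cast_sub hj']
  ring

/-- Radial orthogonality and normalization. -/
theorem integral_zernikeRadial_mul (m N N' : ℕ) :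
    ∫ t in (0 : ℝ)..1, zernikeRadial (m + 2 * N) m t * zernikeRadial (m + 2 * N') m t * t =
      if N = N' then (1 / (2 * (m + 2 * N + 1)) : ℝ) else 0 := by
  wlog h : N' ≤ N generalizing N N'
  · have h1 := this N' N (le_of_not_ge h)
    rw [if_neg (by omega)] at h1 ⊢
    rw [← h1]
    congr 1
    ext t
    ring
  have h1 : ∀ t : ℝ, zernikeRadial (m + 2 * N) m t * zernikeRadial (m + 2 * N') m t * t =
      ∑ j ∈ Finset.range (N' + 1), radialCoeff m N' j *
        (zernikeRadial (m + 2 * N) m t * t ^ (m + 2 * (N' - j)) * t) := fun t => by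
    rw [zernikeRadial_eq' m N', Finset.mul_sum, Finset.sum_mul]
    refine Finset.sum_congr rfl fun j _ => ?_
    ring
  simp only [h1]
  have hc := continuous_zernikeRadial (m + 2 * N) m
  rw [intervalIntegral.integral_finsetSum fun j _ =>
    (by fun_prop : Continuous _).intervalIntegrable 0 1]
  simp only [intervalIntegral.integral_const_mul]
  rw [Finset.sum_congr rfl fun j _ => by
    rw [integral_zernikeRadial_mul_pow m N (N' - j) (by omega)], Finset.sum_eq_single 0]
  · rw [Nat.sub_zero]
    by_cases hN : N = N'
    · subst hN
      rw [if_pos rfl, if_pos rfl, radialCoeff, Nat.factorial_succ]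
      simp only [Nat.sub_zero]
      push_cast
      have h2 : ((m + N).factorial : ℝ) ≠ 0 := by positivity
      have h3 : (N.factorial : ℝ) ≠ 0 := by positivity
      have h4 : ((m + 2 * N).factorial : ℝ) ≠ 0 := by positivity
      field_simp
      simp
    · rw [if_neg (Ne.symm hN), if_neg hN, mul_zero]
  · intro j hj hj0
    have := Finset.mem_range.1 hj
    rw [if_neg (by omega), mul_zero]
  · simp

/-! ### Angular orthogonality -/

theorem integral_cos_int_mul (m : ℤ) :
    ∫ φ in (-Real.pi)..Real.pi, Real.cos (m * φ) = if m = 0 then 2 * Real.pi else 0 := by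
  split_ifs with h
  · simp [h]; ring
  · have hm : (m : ℝ) ≠ 0 := Int.cast_ne_zero.2 h
    rw [intervalIntegral.integral_comp_mul_left (fun x => Real.cos x) hm, integral_cos, mul_neg,
      Real.sin_neg, Real.sin_int_mul_pi]
    simp

theorem integral_sin_int_mul (m : ℤ) :
    ∫ φ in (-Real.pi)..Real.pi, Real.sin (m * φ) = 0 := by
  by_cases h : m = 0
  · simp [h]
  · have hm : (m : ℝ) ≠ 0 := Int.cast_ne_zero.2 h
    rw [intervalIntegral.integral_comp_mul_left (fun x => Real.sin x) hm, integral_sin, mul_neg,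
      Real.cos_neg, sub_self, smul_zero]

theorem integral_cos_mul_cos (m m' : ℤ) :
    ∫ φ in (-Real.pi)..Real.pi, Real.cos (m * φ) * Real.cos (m' * φ) =
      ((if m - m' = 0 then 2 * Real.pi else 0) + if m + m' = 0 then 2 * Real.pi else 0) / 2 := by
  have h : ∀ φ : ℝ, Real.cos (m * φ) * Real.cos (m' * φ) =
      (Real.cos ((m - m' : ℤ) * φ) + Real.cos ((m + m' : ℤ) * φ)) / 2 := fun φ => by
    push_cast
    rw [sub_mul, add_mul, Real.cos_sub, Real.cos_add]
    ring
  simp only [h]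
  rw [intervalIntegral.integral_div, intervalIntegral.integral_add
    ((by fun_prop : Continuous _).intervalIntegrable _ _)
    ((by fun_prop : Continuous _).intervalIntegrable _ _), integral_cos_int_mul,
    integral_cos_int_mul]

theorem integral_sin_mul_sin (m m' : ℤ) :
    ∫ φ in (-Real.pi)..Real.pi, Real.sin (m * φ) * Real.sin (m' * φ) =
      ((if m - m' = 0 then 2 * Real.pi else 0) - if m + m' = 0 then 2 * Real.pi else 0) / 2 := by
  have h : ∀ φ : ℝ, Real.sin (m * φ) * Real.sin (m' * φ) =
      (Real.cos ((m - m' : ℤ) * φ) - Real.cos ((m + m' : ℤ) * φ)) / 2 := fun φ => by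
    push_cast
    rw [sub_mul, add_mul, Real.cos_sub, Real.cos_add]
    ring
  simp only [h]
  rw [intervalIntegral.integral_div, intervalIntegral.integral_sub
    ((by fun_prop : Continuous _).intervalIntegrable _ _)
    ((by fun_prop : Continuous _).intervalIntegrable _ _), integral_cos_int_mul,
    integral_cos_int_mul]

theorem integral_cos_mul_sin (m m' : ℤ) :
    ∫ φ in (-Real.pi)..Real.pi, Real.cos (m * φ) * Real.sin (m' * φ) = 0 := by
  have h : ∀ φ : ℝ, Real.cos (m * φ) * Real.sin (m' * φ) =
      (Real.sin ((m + m' : ℤ) * φ) - Real.sin ((m - m' : ℤ) * φ)) / 2 := fun φ => by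
    push_cast
    rw [sub_mul, add_mul, Real.sin_sub, Real.sin_add]
    ring
  simp only [h]
  rw [intervalIntegral.integral_div, intervalIntegral.integral_sub
    ((by fun_prop : Continuous _).intervalIntegrable _ _)
    ((by fun_prop : Continuous _).intervalIntegrable _ _), integral_sin_int_mul,
    integral_sin_int_mul, sub_self, zero_div]

theorem integral_zernikeAngular_mul (m m' : ℤ) :
    ∫ φ in (-Real.pi)..Real.pi, zernikeAngular m φ * zernikeAngular m' φ =
      if m = m' then (if m = 0 then 2 * Real.pi else Real.pi) else 0 := by
  have hc (n : ℤ) (hn : 0 ≤ n) (φ : ℝ) : zernikeAngular n φ = Real.cos (n * φ) := if_pos hn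
  have hs (n : ℤ) (hn : ¬ 0 ≤ n) (φ : ℝ) : zernikeAngular n φ = Real.sin ((-n : ℤ) * φ) := by
    rw [zernikeAngular, if_neg hn, ← Int.cast_natCast, Int.ofNat_natAbs_of_nonpos (by omega)]
  by_cases hm : 0 ≤ m <;> by_cases hm' : 0 ≤ m'
  · simp only [hc m hm, hc m' hm', integral_cos_mul_cos]
    split_ifs <;> first | omega | ring
  · simp only [hc m hm, hs m' hm', integral_cos_mul_sin]
    rw [if_neg (by omega)]
  · simp only [hs m hm, hc m' hm']
    rw [if_neg (by omega)]
    simp only [mul_comm (Real.sin _), integral_cos_mul_sin]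
  · simp only [hs m hm, hs m' hm', integral_sin_mul_sin]
    split_ifs <;> first | omega | ring

/-! ### Polar coordinates -/

theorem setIntegral_closedBall_polar (a : ℝ) (ha : 0 ≤ a) (F G : ℝ → ℝ) :
    ∫ x in Metric.closedBall (0 : Plane) a, F ‖x‖ * G (polarAngle x) =
      (∫ r in (0 : ℝ)..a, r * F r) * ∫ φ in (-Real.pi)..Real.pi, G φ := by
  set b := Complex.orthonormalBasisOneI
  have hb : ∀ z : ℂ, polarAngle (b.repr z) = Complex.arg z := fun z => by
    have h0 : (b.repr z) 0 = z.re := by simp [b]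
    have h1 : (b.repr z) 1 = z.im := by simp [b]
    rw [polarAngle, h0, h1]
  rw [← integral_indicator measurableSet_closedBall,
    ← b.measurePreserving_repr.integral_comp b.repr.toHomeomorph.measurableEmbedding,
    ← Complex.integral_comp_polarCoord_symm, polarCoord_target]
  have h1 : ∀ p ∈ Set.Ioi (0 : ℝ) ×ˢ Set.Ioo (-Real.pi) Real.pi,
      p.1 • (Metric.closedBall (0 : Plane) a).indicator (fun x => F ‖x‖ * G (polarAngle x))
        (b.repr (Complex.polarCoord.symm p)) =
      (Set.Iic a).indicator (fun r => r * F r) p.1 * G p.2 := by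
    rintro ⟨r, φ⟩ ⟨hr, hφ⟩
    have hr : 0 < r := hr
    have hn : ‖b.repr (Complex.polarCoord.symm (r, φ))‖ = r := by
      rw [LinearIsometryEquiv.norm_map, Complex.norm_polarCoord_symm, abs_of_pos hr]
    have harg : Complex.arg (Complex.polarCoord.symm (r, φ)) = φ := by
      rw [Complex.polarCoord_symm_apply, Complex.ofReal_cos, Complex.ofReal_sin]
      exact Complex.arg_mul_cos_add_sin_mul_I hr ⟨hφ.1, hφ.2.le⟩
    by_cases h : r ≤ a
    · rw [Set.indicator_of_mem (mem_closedBall_zero_iff.2 (hn.trans_le h)),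
        Set.indicator_of_mem (Set.mem_Iic.2 h), hn, hb, harg, smul_eq_mul, mul_assoc]
    · rw [Set.indicator_of_notMem (fun h' => h (hn.ge.trans (mem_closedBall_zero_iff.1 h'))),
        Set.indicator_of_notMem (fun h' => h (Set.mem_Iic.1 h')), smul_zero, zero_mul]
  rw [setIntegral_congr_fun (measurableSet_Ioi.prod measurableSet_Ioo) h1, Measure.volume_eq_prod,
    setIntegral_prod_mul, setIntegral_indicator measurableSet_Iic, Set.Ioi_inter_Iic,
    ← integral_Ioc_eq_integral_Ioo, intervalIntegral.integral_of_le ha,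
    intervalIntegral.integral_of_le (by linarith [Real.pi_pos])]

/-! ### Zernike polynomials in Cartesian coordinates -/

/-- The point `x` of the pupil plane as a complex number. -/
def toComplex (x : Plane) : ℂ := ⟨x 0, x 1⟩

theorem norm_toComplex (x : Plane) : ‖toComplex x‖ = ‖x‖ := by
  rw [EuclideanSpace.norm_eq, Fin.sum_univ_two, Complex.norm_def, Complex.normSq_apply, toComplex]
  simp [sq]

theorem continuous_toComplex : Continuous toComplex := by
  have : toComplex = fun x : Plane => (x 0 : ℂ) + (x 1 : ℂ) * Complex.I := by
    funext x
    exact Complex.mk_eq_add_mul_I _ _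
  rw [this]
  fun_prop

/-- The harmonic polynomial `r ^ |m| cos (m φ)` or `r ^ |m| sin (|m| φ)`. -/
def harmonicPoly (m : ℤ) : C(Plane, ℝ) :=
  if 0 ≤ m then ⟨fun x => (toComplex x ^ m.natAbs).re, by have := continuous_toComplex; fun_prop⟩
  else ⟨fun x => (toComplex x ^ m.natAbs).im, by have := continuous_toComplex; fun_prop⟩

theorem harmonicPoly_of_nonneg {m : ℤ} (hm : 0 ≤ m) (x : Plane) :
    harmonicPoly m x = (toComplex x ^ m.natAbs).re := by
  rw [harmonicPoly, if_pos hm]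
  rfl

theorem harmonicPoly_of_neg {m : ℤ} (hm : m < 0) (x : Plane) :
    harmonicPoly m x = (toComplex x ^ m.natAbs).im := by
  rw [harmonicPoly, if_neg hm.not_ge]
  rfl

theorem harmonicPoly_eq_polar (m : ℤ) (x : Plane) :
    harmonicPoly m x = ‖x‖ ^ m.natAbs * zernikeAngular m (polarAngle x) := by
  have h1 : toComplex x ^ m.natAbs = ((‖x‖ ^ m.natAbs : ℝ) : ℂ) *
      (Complex.cos ((m.natAbs * polarAngle x : ℝ) : ℂ) +
        Complex.sin ((m.natAbs * polarAngle x : ℝ) : ℂ) * Complex.I) := by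
    conv_lhs => rw [← Complex.norm_mul_cos_add_sin_mul_I (toComplex x), norm_toComplex, mul_pow,
      Complex.cos_add_sin_mul_I_pow]
    push_cast
    rfl
  rw [← Complex.ofReal_cos, ← Complex.ofReal_sin] at h1
  rcases lt_or_ge m 0 with hm | hm
  · rw [harmonicPoly_of_neg hm, h1, zernikeAngular, if_neg hm.not_ge, Complex.im_ofReal_mul]
    simp only [Complex.add_im, Complex.ofReal_im, Complex.im_ofReal_mul, Complex.I_im, mul_one,
      zero_add]
  · rw [harmonicPoly_of_nonneg hm, h1, zernikeAngular, if_pos hm, Complex.re_ofReal_mul]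
    have : ((m.natAbs : ℕ) : ℝ) = (m : ℝ) := by
      rw [← Int.cast_natCast, Int.natAbs_of_nonneg hm]
    simp only [Complex.add_re, Complex.ofReal_re, Complex.re_ofReal_mul, Complex.I_re, mul_zero,
      add_zero, this]

/-- The polynomial `r ^ (2 q)` times a harmonic polynomial; these span all polynomials. -/
def polarMonomial (m : ℤ) (q : ℕ) : C(Plane, ℝ) :=
  ⟨fun x => (‖x‖ ^ 2) ^ q, by fun_prop⟩ * harmonicPoly m

theorem polarMonomial_apply (m : ℤ) (q : ℕ) (x : Plane) :
    polarMonomial m q x = (‖x‖ ^ 2) ^ q * harmonicPoly m x := rfl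

/-- The polynomial that `Z_n^m` is on the disc. -/
def zernikePoly (a : ℝ) (p : ZernikeIndex) : C(Plane, ℝ) :=
  zernikeNorm a p.1.1 p.1.2 • ∑ j ∈ Finset.range ((p.1.1 - p.1.2.natAbs) / 2 + 1),
    (radialCoeff p.1.2.natAbs ((p.1.1 - p.1.2.natAbs) / 2) j *
      (a⁻¹) ^ (p.1.2.natAbs + 2 * ((p.1.1 - p.1.2.natAbs) / 2 - j))) •
      polarMonomial p.1.2 ((p.1.1 - p.1.2.natAbs) / 2 - j)

theorem ZernikeIndex.fst_eq (p : ZernikeIndex) :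
    p.1.2.natAbs + 2 * ((p.1.1 - p.1.2.natAbs) / 2) = p.1.1 := by
  have h1 := p.2.1
  obtain ⟨c, hc⟩ := p.2.2
  omega

theorem zernikePoly_apply (a : ℝ) (p : ZernikeIndex) (x : Plane) :
    zernikePoly a p x = zernikeNorm a p.1.1 p.1.2 * zernikeRadial p.1.1 p.1.2.natAbs (‖x‖ / a) *
      zernikeAngular p.1.2 (polarAngle x) := by
  have h := zernikeRadial_eq' p.1.2.natAbs ((p.1.1 - p.1.2.natAbs) / 2) (‖x‖ / a)
  rw [p.fst_eq] at h
  rw [h, zernikePoly, ContinuousMap.smul_apply, ContinuousMap.sum_apply, smul_eq_mul, mul_assoc,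
    Finset.sum_mul]
  congr 1
  refine Finset.sum_congr rfl fun j _ => ?_
  rw [ContinuousMap.smul_apply, smul_eq_mul, polarMonomial_apply, harmonicPoly_eq_polar,
    div_eq_mul_inv, mul_pow, pow_add ‖x‖, pow_mul]
  ring

theorem zernike_eq (a : ℝ) (p : ZernikeIndex) : zernike a p = discVec a (zernikePoly a p) := by
  refine MemLp.toLp_congr _ (memLp_discReal a _) (Eventually.of_forall fun x => ?_)
  simp only [zernikeFun, zernikePoly_apply]

theorem orthonormal_zernike {a : ℝ} (ha : 0 < a) : Orthonormal ℂ (zernike a) := by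
  classical
  rw [orthonormal_iff_ite]
  intro p p'
  rw [zernike_eq, zernike_eq, inner_discVec]
  have h1 : ∫ x in Metric.closedBall (0 : Plane) a, zernikePoly a p x * zernikePoly a p' x = _ :=
    (setIntegral_congr_fun measurableSet_closedBall fun x _ => by
      rw [zernikePoly_apply, zernikePoly_apply]
      ring).trans (setIntegral_closedBall_polar a ha.le
      (fun r => zernikeNorm a p.1.1 p.1.2 * zernikeNorm a p'.1.1 p'.1.2 *
        (zernikeRadial p.1.1 p.1.2.natAbs (r / a) * zernikeRadial p'.1.1 p'.1.2.natAbs (r / a)))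
      (fun φ => zernikeAngular p.1.2 φ * zernikeAngular p'.1.2 φ))
  rw [h1, integral_zernikeAngular_mul]
  by_cases hm : p.1.2 = p'.1.2
  swap
  · rw [if_neg hm, mul_zero, if_neg fun h => hm (by rw [h]), Complex.ofReal_zero]
  have h2 : ∫ r in (0 : ℝ)..a, r * (zernikeNorm a p.1.1 p.1.2 * zernikeNorm a p'.1.1 p'.1.2 *
        (zernikeRadial p.1.1 p.1.2.natAbs (r / a) * zernikeRadial p'.1.1 p'.1.2.natAbs (r / a))) =
      zernikeNorm a p.1.1 p.1.2 * zernikeNorm a p'.1.1 p'.1.2 * a ^ 2 *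
        ∫ t in (0 : ℝ)..1, zernikeRadial p.1.1 p.1.2.natAbs t *
          zernikeRadial p'.1.1 p'.1.2.natAbs t * t := by
    have h3 : ∀ r : ℝ, r * (zernikeNorm a p.1.1 p.1.2 * zernikeNorm a p'.1.1 p'.1.2 *
        (zernikeRadial p.1.1 p.1.2.natAbs (r / a) *
          zernikeRadial p'.1.1 p'.1.2.natAbs (r / a))) =
        (zernikeNorm a p.1.1 p.1.2 * zernikeNorm a p'.1.1 p'.1.2 * a) *
        (fun t => zernikeRadial p.1.1 p.1.2.natAbs t *
          zernikeRadial p'.1.1 p'.1.2.natAbs t * t) (r / a) := fun r => by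
      field_simp
    simp only [h3]
    rw [intervalIntegral.integral_const_mul,
      intervalIntegral.integral_comp_div (fun t => zernikeRadial p.1.1 p.1.2.natAbs t *
          zernikeRadial p'.1.1 p'.1.2.natAbs t * t) ha.ne', zero_div, div_self ha.ne', smul_eq_mul]
    ring
  have h4 := integral_zernikeRadial_mul p.1.2.natAbs ((p.1.1 - p.1.2.natAbs) / 2)
    ((p'.1.1 - p'.1.2.natAbs) / 2)
  rw [p.fst_eq, show p.1.2.natAbs + 2 * ((p'.1.1 - p'.1.2.natAbs) / 2) = p'.1.1 by
    rw [hm]; exact p'.fst_eq] at h4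
  rw [h2, ← hm, h4, if_pos rfl]
  by_cases hN : (p.1.1 - p.1.2.natAbs) / 2 = (p'.1.1 - p'.1.2.natAbs) / 2
  · have hn : p.1.1 = p'.1.1 := by
      rw [← p.fst_eq, ← p'.fst_eq, hN, hm]
    have hp : p = p' := Subtype.ext (Prod.ext hn hm)
    rw [if_pos hN, if_pos hp, ← hn]
    have h5 : ((p.1.2.natAbs : ℝ) + 2 * ((p.1.1 - p.1.2.natAbs) / 2 : ℕ)) = p.1.1 := by
      exact_mod_cast p.fst_eq
    rw [h5, ← Complex.ofReal_one]
    congr 1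
    have hpi := Real.pi_pos
    have h6 : zernikeNorm a p.1.1 p.1.2 * zernikeNorm a p.1.1 p.1.2 =
        ((if p.1.2 = 0 then 1 else 2) * (p.1.1 + 1) / Real.pi) / a ^ 2 := by
      rw [zernikeNorm, div_mul_div_comm, Real.mul_self_sqrt, sq]
      split_ifs <;> positivity
    rw [h6]
    split_ifs <;> field_simp
  · rw [if_neg hN, mul_zero, zero_mul, Complex.ofReal_zero,
      if_neg fun h : p = p' => hN (by rw [h])]

/-! ### The modes of low order -/

theorem zernikeNorm_eq (a : ℝ) (n : ℕ) (m : ℤ) :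
    zernikeNorm a n m =
      Real.sqrt ((if m = 0 then 1 else 2) * (n + 1)) * (1 / (Real.sqrt Real.pi * a)) := by
  rw [zernikeNorm, Real.sqrt_div' _ Real.pi_pos.le]
  ring

theorem zernikePoly_z00 (a : ℝ) :
    zernikePoly a z00 = (1 / (Real.sqrt Real.pi * a)) • 1 := by
  ext x
  rw [zernikePoly_apply, zernikeNorm_eq]
  simp [z00, zernikeRadial, zernikeAngular]

theorem sqrt_four : Real.sqrt 4 = 2 := by
  rw [show (4 : ℝ) = 2 ^ 2 by norm_num, Real.sqrt_sq two_pos.le]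

theorem zernikePoly_z11_apply (a : ℝ) (x : Plane) :
    zernikePoly a z11 x = 2 / a * (1 / (Real.sqrt Real.pi * a) * x 0) := by
  have h := harmonicPoly_eq_polar 1 x
  rw [harmonicPoly_of_nonneg zero_le_one] at h
  have h4 : Real.sqrt (2 * (1 + 1)) = 2 := by norm_num [sqrt_four]
  simp only [Int.natAbs_one, pow_one, toComplex] at h
  rw [zernikePoly_apply, zernikeNorm_eq, h]
  simp [z11, zernikeRadial, h4]
  ring

theorem zernikePoly_z1m1_apply (a : ℝ) (x : Plane) :
    zernikePoly a z1m1 x = 2 / a * (1 / (Real.sqrt Real.pi * a) * x 1) := by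
  have h := harmonicPoly_eq_polar (-1) x
  rw [harmonicPoly_of_neg (by norm_num)] at h
  have h4 : Real.sqrt (2 * (1 + 1)) = 2 := by norm_num [sqrt_four]
  simp only [Int.natAbs_neg, Int.natAbs_one, pow_one, toComplex] at h
  rw [zernikePoly_apply, zernikeNorm_eq, h]
  simp [z1m1, zernikeRadial, h4]
  ring

theorem zernikePoly_z20_apply (a : ℝ) (x : Plane) :
    zernikePoly a z20 x =
      Real.sqrt 3 * (1 / (Real.sqrt Real.pi * a) * (2 * (‖x‖ / a) ^ 2 - 1)) := by
  have h3 : Real.sqrt (2 + 1) = Real.sqrt 3 := by norm_num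
  rw [zernikePoly_apply, zernikeNorm_eq]
  simp [z20, zernikeRadial, zernikeAngular, Finset.sum_range_succ, h3]
  ring

theorem zernike_z00 (k a : ℝ) : zernike a z00 = cosVec k a 0 := by
  rw [zernike_eq, zernikePoly_z00, cosVec_zero]

theorem sinDeriv_dir_zero (k : ℝ) {a : ℝ} (ha : a ≠ 0) :
    sinDeriv k a 0 (dir 0) = ((k * a / 2 : ℝ) : ℂ) • zernike a z11 := by
  rw [sinDeriv_zero, zernike_eq, discVec_smul_complex]
  congr 1
  ext x
  rw [ContinuousMap.smul_apply, ContinuousMap.smul_apply, zernikePoly_z11_apply, phase_apply]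
  simp
  field_simp

theorem sinDeriv_dir_one (k : ℝ) {a : ℝ} (ha : a ≠ 0) :
    sinDeriv k a 0 (dir 1) = ((k * a / 2 : ℝ) : ℂ) • zernike a z1m1 := by
  rw [sinDeriv_zero, zernike_eq, discVec_smul_complex]
  congr 1
  ext x
  rw [ContinuousMap.smul_apply, ContinuousMap.smul_apply, zernikePoly_z1m1_apply, phase_apply]
  simp
  field_simp

theorem sinDeriv_dir_two (k : ℝ) {a : ℝ} (ha : a ≠ 0) :
    sinDeriv k a 0 (dir 2) = ((-(k * a ^ 2 / (4 * Real.sqrt 3)) : ℝ) : ℂ) • zernike a z20 +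
      ((-(k * a ^ 2 / 4) : ℝ) : ℂ) • zernike a z00 := by
  rw [sinDeriv_zero, zernike_eq, zernike_eq, discVec_smul_complex, discVec_smul_complex, ← map_add]
  congr 1
  ext x
  have h3 : Real.sqrt 3 ≠ 0 := by positivity
  rw [ContinuousMap.add_apply, ContinuousMap.smul_apply, ContinuousMap.smul_apply,
    ContinuousMap.smul_apply, zernikePoly_z20_apply, zernikePoly_z00, phase_apply]
  simp
  field_simp
  ring

/-! ### Completeness of the Zernike modes -/

theorem radialCoeff_ne_zero (m N j : ℕ) : radialCoeff m N j ≠ 0 := by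
  unfold radialCoeff
  positivity

theorem zernikeNorm_ne_zero {a : ℝ} (ha : a ≠ 0) (n : ℕ) (m : ℤ) : zernikeNorm a n m ≠ 0 := by
  rw [zernikeNorm_eq]
  have : Real.sqrt ((if m = 0 then 1 else 2) * (n + 1)) ≠ 0 := by
    rw [Real.sqrt_ne_zero']
    split_ifs <;> positivity
  positivity

/-- The radial polynomials are triangular in the powers of the radius. -/
theorem polarMonomial_mem_span {a : ℝ} (ha : a ≠ 0) (m : ℤ) (q : ℕ) :
    polarMonomial m q ∈ Submodule.span ℝ (Set.range (zernikePoly a)) := by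
  induction q using Nat.strong_induction_on with
  | _ q ih =>
    let p : ZernikeIndex := ⟨(m.natAbs + 2 * q, m), by dsimp only; omega, by
      dsimp only
      rw [Nat.add_sub_cancel_left]
      exact even_two_mul q⟩
    have hp : zernikePoly a p ∈ Submodule.span ℝ (Set.range (zernikePoly a)) :=
      Submodule.subset_span ⟨p, rfl⟩
    have hq : (m.natAbs + 2 * q - m.natAbs) / 2 = q := by omega
    rw [zernikePoly, Submodule.smul_mem_iff _ (zernikeNorm_ne_zero ha _ _),
      Finset.sum_range_succ'] at hp
    simp only [p, hq, Nat.sub_zero] at hp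
    rw [Submodule.add_mem_iff_right, Submodule.smul_mem_iff] at hp
    · exact hp
    · exact mul_ne_zero (radialCoeff_ne_zero _ _ _) (pow_ne_zero _ (inv_ne_zero ha))
    · refine Submodule.sum_mem _ fun j hj => Submodule.smul_mem _ _ (ih _ ?_)
      have := Finset.mem_range.1 hj
      omega

/-- The `i`-th coordinate function on the pupil plane. -/
def coordFun (i : Fin 2) : C(Plane, ℝ) := ⟨fun x => x i, by fun_prop⟩

theorem coordFun_apply (i : Fin 2) (x : Plane) : coordFun i x = x i := rfl

theorem polarMonomial_natCast_apply (n q : ℕ) (x : Plane) :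
    polarMonomial (n : ℤ) q x = (‖x‖ ^ 2) ^ q * (toComplex x ^ n).re := by
  rw [polarMonomial_apply, harmonicPoly_of_nonneg (Int.natCast_nonneg n), Int.natAbs_natCast]

theorem polarMonomial_neg_apply (n q : ℕ) (x : Plane) :
    polarMonomial (-((n : ℤ) + 1)) q x = (‖x‖ ^ 2) ^ q * (toComplex x ^ (n + 1)).im := by
  rw [polarMonomial_apply, harmonicPoly_of_neg (by omega),
    show (-((n : ℤ) + 1)).natAbs = n + 1 by omega]

theorem norm_sq_eq (x : Plane) : ‖x‖ ^ 2 = x 0 ^ 2 + x 1 ^ 2 := by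
  rw [EuclideanSpace.norm_sq_eq, Fin.sum_univ_two, Real.norm_eq_abs, Real.norm_eq_abs, sq_abs,
    sq_abs]

/-- Multiplication by a coordinate shifts the angular order by one, since
`2 x₁ zⁿ = zⁿ⁺¹ + |z|² zⁿ⁻¹` and `2 i x₂ zⁿ = zⁿ⁺¹ - |z|² zⁿ⁻¹`. -/
theorem coordFun_mul_polarMonomial_mem (i : Fin 2) (m : ℤ) (q : ℕ) :
    coordFun i * polarMonomial m q ∈
      Submodule.span ℝ (Set.range fun p : ℤ × ℕ => polarMonomial p.1 p.2) := by
  set U := Submodule.span ℝ (Set.range fun p : ℤ × ℕ => polarMonomial p.1 p.2)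
  have hU (m : ℤ) (q : ℕ) : polarMonomial m q ∈ U := Submodule.subset_span ⟨(m, q), rfl⟩
  have hhalf (f g h : C(Plane, ℝ)) (hg : g ∈ U) (hh : h ∈ U)
      (hf : ∀ x, f x = (1 / 2 : ℝ) * (g x + h x)) : f ∈ U := by
    have : f = (1 / 2 : ℝ) • (g + h) := ContinuousMap.ext hf
    rw [this]
    exact U.smul_mem _ (U.add_mem hg hh)
  obtain ⟨n, rfl | rfl⟩ : ∃ n : ℕ, m = n ∨ m = -((n : ℤ) + 1) := by
    rcases lt_or_ge m 0 with h | h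
    · exact ⟨(-m - 1).toNat, Or.inr (by omega)⟩
    · exact ⟨m.toNat, Or.inl (by omega)⟩
  -- The orders `0` and `±1` are separate cases: the lower order `n - 1` changes sign or vanishes.
  · rcases n with _ | n
    · fin_cases i
      · refine hhalf _ (polarMonomial (1 : ℕ) q) (polarMonomial (1 : ℕ) q) (hU _ _) (hU _ _)
          fun x => ?_
        rw [ContinuousMap.mul_apply, coordFun_apply, polarMonomial_natCast_apply,
          polarMonomial_natCast_apply]
        simp [toComplex]
        ring
      · refine hhalf _ (polarMonomial (-((0 : ℕ) + 1)) q) (polarMonomial (-((0 : ℕ) + 1)) q)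
          (hU _ _) (hU _ _) fun x => ?_
        rw [ContinuousMap.mul_apply, coordFun_apply, polarMonomial_natCast_apply,
          polarMonomial_neg_apply]
        simp [toComplex]
        ring
    · fin_cases i
      · refine hhalf _ (polarMonomial (n + 2 : ℕ) q) (polarMonomial n (q + 1)) (hU _ _) (hU _ _)
          fun x => ?_
        rw [ContinuousMap.mul_apply, coordFun_apply, polarMonomial_natCast_apply,
          polarMonomial_natCast_apply, polarMonomial_natCast_apply, pow_succ (‖x‖ ^ 2) q,
          norm_sq_eq, pow_succ _ n, pow_add _ n 2, sq (toComplex x)]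
        simp only [toComplex, Complex.mul_re, Complex.mul_im]
        simp
        ring
      · rcases n with _ | n
        · refine hhalf _ (polarMonomial (-((1 : ℕ) + 1)) q) 0 (hU _ _) U.zero_mem fun x => ?_
          rw [ContinuousMap.mul_apply, coordFun_apply, polarMonomial_natCast_apply,
            polarMonomial_neg_apply]
          simp [toComplex, sq, Complex.mul_im]
          ring
        · refine hhalf _ (polarMonomial (-((n + 2 : ℕ) + 1)) q)
            (-polarMonomial (-((n : ℕ) + 1)) (q + 1)) (hU _ _) (U.neg_mem (hU _ _)) fun x => ?_
          rw [ContinuousMap.mul_apply, coordFun_apply, ContinuousMap.neg_apply,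
            polarMonomial_natCast_apply, polarMonomial_neg_apply, polarMonomial_neg_apply,
            pow_succ (‖x‖ ^ 2) q, norm_sq_eq, pow_succ _ (n + 1), pow_succ _ (n + 2),
            pow_succ _ (n + 1)]
          simp only [toComplex, Complex.mul_re, Complex.mul_im]
          simp
          ring
  · fin_cases i
    · rcases n with _ | n
      · refine hhalf _ (polarMonomial (-((1 : ℕ) + 1)) q) 0 (hU _ _) U.zero_mem fun x => ?_
        rw [ContinuousMap.mul_apply, coordFun_apply, polarMonomial_neg_apply,
          polarMonomial_neg_apply]
        simp [toComplex, sq, Complex.mul_im]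
        ring
      · refine hhalf _ (polarMonomial (-((n + 2 : ℕ) + 1)) q)
          (polarMonomial (-((n : ℕ) + 1)) (q + 1)) (hU _ _) (hU _ _) fun x => ?_
        rw [ContinuousMap.mul_apply, coordFun_apply, polarMonomial_neg_apply,
          polarMonomial_neg_apply, polarMonomial_neg_apply,
          pow_succ (‖x‖ ^ 2) q, norm_sq_eq, pow_succ _ (n + 1), pow_succ _ (n + 2),
          pow_succ _ (n + 1)]
        simp only [toComplex, Complex.mul_re, Complex.mul_im]
        simp
        ring
    · refine hhalf _ (-polarMonomial (n + 2 : ℕ) q) (polarMonomial n (q + 1))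
        (U.neg_mem (hU _ _)) (hU _ _) fun x => ?_
      rw [ContinuousMap.mul_apply, coordFun_apply, ContinuousMap.neg_apply,
        polarMonomial_neg_apply, polarMonomial_natCast_apply, polarMonomial_natCast_apply,
        pow_succ (‖x‖ ^ 2) q, norm_sq_eq, pow_succ _ n, pow_add _ n 2, sq (toComplex x)]
      simp only [toComplex, Complex.mul_re, Complex.mul_im]
      simp
      ring

theorem adjoin_coordFun_le_span {a : ℝ} (ha : a ≠ 0) {f : C(Plane, ℝ)}
    (hf : f ∈ Algebra.adjoin ℝ (Set.range coordFun)) :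
    f ∈ Submodule.span ℝ (Set.range (zernikePoly a)) := by
  set U := Submodule.span ℝ (Set.range fun p : ℤ × ℕ => polarMonomial p.1 p.2)
  have h1 : ∀ u ∈ U, f * u ∈ U := by
    induction hf using Algebra.adjoin_induction with
    | mem g hg =>
      obtain ⟨i, rfl⟩ := hg
      intro u hu
      induction hu using Submodule.span_induction with
      | mem v hv =>
        obtain ⟨p, rfl⟩ := hv
        exact coordFun_mul_polarMonomial_mem i p.1 p.2
      | zero => rw [mul_zero]; exact U.zero_mem
      | add v w _ _ hv hw => rw [mul_add]; exact U.add_mem hv hw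
      | smul c v _ hv => rw [mul_smul_comm]; exact U.smul_mem c hv
    | algebraMap r => intro u hu; rw [← Algebra.smul_def]; exact U.smul_mem r hu
    | add g h _ _ hg hh => intro u hu; rw [add_mul]; exact U.add_mem (hg u hu) (hh u hu)
    | mul g h _ _ hg hh => intro u hu; rw [mul_assoc]; exact hg _ (hh u hu)
  have h2 : (1 : C(Plane, ℝ)) ∈ U := by
    have : polarMonomial (0 : ℕ) 0 = 1 := by
      ext x
      rw [polarMonomial_natCast_apply]
      simp
    rw [← this]
    exact Submodule.subset_span ⟨(0, 0), rfl⟩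
  have h3 := h1 1 h2
  rw [mul_one] at h3
  refine Submodule.span_le.2 ?_ h3
  rintro _ ⟨p, rfl⟩
  exact polarMonomial_mem_span ha p.1 p.2

/-- A vector orthogonal to all Zernike modes is orthogonal to all continuous functions on the disc,
by the Stone–Weierstrass theorem. -/
theorem inner_discVec_eq_zero_of_zernike {a : ℝ} (ha : a ≠ 0) {v : Hilb}
    (hv : ∀ p, inner ℂ (zernike a p) v = 0) (g : C(Plane, ℝ)) : inner ℂ (discVec a g) v = 0 := by
  have hspan : ∀ f ∈ Submodule.span ℝ (Set.range (zernikePoly a)), inner ℂ (discVec a f) v = 0 := by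
    intro f hf
    induction hf using Submodule.span_induction with
    | mem f hf =>
      obtain ⟨p, rfl⟩ := hf
      rw [← zernike_eq, hv]
    | zero => rw [map_zero, inner_zero_left]
    | add f g _ _ hf hg => rw [map_add, inner_add_left, hf, hg, add_zero]
    | smul c f _ hf => rw [← discVec_smul_complex, inner_smul_left, hf, mul_zero]
  have hsep : (Algebra.adjoin ℝ (Set.range coordFun)).SeparatesPoints := by
    intro x y hxy
    obtain ⟨i, hi⟩ : ∃ i, x i ≠ y i := by
      by_contra! h
      exact hxy (PiLp.ext h)
    exact ⟨_, ⟨coordFun i, Algebra.subset_adjoin ⟨i, rfl⟩, rfl⟩, hi⟩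
  rw [← norm_le_zero_iff]
  refine le_of_forall_pos_le_add fun ε hε => ?_
  set C := ‖discVec a 1‖ * ‖v‖
  have hC : 0 ≤ C := by positivity
  obtain ⟨f, hf, hfg⟩ :=
    ContinuousMap.exists_mem_subalgebra_near_continuous_of_isCompact_of_separatesPoints hsep g
      (isCompact_closedBall (0 : Plane) a) (ε := ε / (C + 1)) (by positivity)
  have h1 : inner ℂ (discVec a g) v = -inner ℂ (discVec a (f - g)) v := by
    rw [map_sub, inner_sub_left, hspan f (adjoin_coordFun_le_span ha hf), zero_sub, neg_neg]
  rw [h1, norm_neg, zero_add]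
  calc _ ≤ ‖discVec a (f - g)‖ * ‖v‖ := norm_inner_le_norm _ _
    _ ≤ ε / (C + 1) * ‖discVec a 1‖ * ‖v‖ := by
        gcongr
        exact norm_discVec_le a _ _ fun x hx => (hfg x hx).le
    _ = ε * (C / (C + 1)) := by ring
    _ ≤ ε * 1 := by
        gcongr
        exact (div_le_one (by positivity)).2 (by linarith)
    _ = ε := mul_one ε

/-- The Zernike modes and the vectors vanishing on the pupil are total in `L²(ℝ²)`. -/
theorem eq_zero_of_inner_zernike {a : ℝ} (ha : a ≠ 0) {v : Hilb}
    (hv : ∀ p, inner ℂ (zernike a p) v = 0) (hv' : ∀ f ∈ vanishingOnPupil a, inner ℂ f v = 0) :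
    v = 0 := by
  have hout : ∀ᵐ x : Plane, x ∉ Metric.closedBall (0 : Plane) a → v x = 0 := by
    have hm : MemLp ((Metric.closedBall (0 : Plane) a)ᶜ.indicator v) 2 volume :=
      (Lp.memLp v).indicator measurableSet_closedBall.compl
    have h1 : hm.toLp ∈ vanishingOnPupil a := by
      filter_upwards [hm.coeFn_toLp] with x hx hxa
      rw [hx, Set.indicator_of_notMem]
      simpa using hxa
    have h2 : inner ℂ hm.toLp v = inner ℂ hm.toLp hm.toLp := by
      rw [L2.inner_def, L2.inner_def]
      refine integral_congr_ae ?_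
      filter_upwards [hm.coeFn_toLp] with x hx
      rw [hx]
      by_cases h : x ∈ (Metric.closedBall (0 : Plane) a)ᶜ
      · rw [Set.indicator_of_mem h]
      · rw [Set.indicator_of_notMem h, inner_zero_left, inner_zero_left]
    rw [hv' _ h1] at h2
    have h3 : hm.toLp = 0 := inner_self_eq_zero.1 h2.symm
    filter_upwards [hm.coeFn_toLp, Lp.coeFn_zero ℂ 2 (volume : Measure Plane)] with x hx hx0 hxa
    rw [h3, hx0, Set.indicator_of_mem (show x ∈ (Metric.closedBall (0 : Plane) a)ᶜ from hxa)] at hx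
    exact hx.symm
  have hloc : LocallyIntegrable v (volume : Measure Plane) :=
    (Lp.memLp v).locallyIntegrable (by norm_num)
  have h0 := ae_eq_zero_of_integral_contDiff_smul_eq_zero hloc fun g hg _ => by
    have h1 := inner_discVec_eq_zero_of_zernike ha hv ⟨g, hg.continuous⟩
    rw [inner_discVec_left, ← integral_indicator measurableSet_closedBall] at h1
    rw [← h1]
    refine integral_congr_ae ?_
    filter_upwards [hout] with x hx
    by_cases h : x ∈ Metric.closedBall (0 : Plane) a
    · rw [Set.indicator_of_mem h]
      rfl
    · rw [Set.indicator_of_notMem h, hx h, smul_zero]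
  exact Lp.eq_zero_iff_ae_eq_zero.2 h0

/-! ### The Zernike measurement -/

/-- The mode carrying the derivative with respect to `sᵢ`. -/
def derivMode : Fin 3 → ZernikeIndex := ![z11, z1m1, z20]

/-- The component of the derivative with respect to `sᵢ` along its mode. -/
def derivCoeff (k a : ℝ) : Fin 3 → ℝ := ![k * a / 2, k * a / 2, -(k * a ^ 2 / (4 * Real.sqrt 3))]

/-- The component of the derivative with respect to `sᵢ` along `Φ₀`. -/
def derivPhase (k a : ℝ) : Fin 3 → ℝ := ![0, 0, -(k * a ^ 2 / 4)]

theorem sinDeriv_dir (k : ℝ) {a : ℝ} (ha : a ≠ 0) (i : Fin 3) :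
    sinDeriv k a 0 (dir i) = (derivCoeff k a i : ℂ) • zernike a (derivMode i) +
      (derivPhase k a i : ℂ) • zernike a z00 := by
  fin_cases i
  · simpa [derivCoeff, derivMode, derivPhase] using sinDeriv_dir_zero k ha
  · simpa [derivCoeff, derivMode, derivPhase] using sinDeriv_dir_one k ha
  · simpa [derivCoeff, derivMode, derivPhase] using sinDeriv_dir_two k ha

theorem derivMode_injective : Function.Injective derivMode := by
  intro i j h
  fin_cases i <;> fin_cases j <;>
    first | rfl | exact absurd (congrArg (fun p : ZernikeIndex => p.1) h) (by decide)

theorem derivMode_ne (i : Fin 3) : derivMode i ≠ z00 := by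
  intro h
  fin_cases i <;> exact absurd (congrArg (fun p : ZernikeIndex => p.1) h) (by decide)

theorem inner_zernike_ne {a : ℝ} (ha : 0 < a) {p q : ZernikeIndex} (h : p ≠ q) :
    inner ℂ (zernike a p) (zernike a q) = 0 := (orthonormal_zernike ha).2 h

theorem inner_zernike_self {a : ℝ} (ha : 0 < a) (p : ZernikeIndex) :
    inner ℂ (zernike a p) (zernike a p) = 1 := by
  rw [inner_self_eq_norm_sq_to_K, (orthonormal_zernike ha).1 p, RCLike.ofReal_one, one_pow]

theorem tangent_eq (k : ℝ) {a : ℝ} (ha : 0 < a) (i : Fin 3) :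
    tangent k a i = (derivCoeff k a i : ℂ) • zernike a (derivMode i) := by
  have h1 : (twist k a 0 (dir i) : ℂ) = -(derivPhase k a i : ℂ) := by
    rw [← inner_twist, cosDeriv_zero, inner_zero_left, zero_sub, ← zernike_z00,
      sinDeriv_dir k ha.ne', inner_add_right, inner_smul_right, inner_smul_right,
      inner_zernike_ne ha (derivMode_ne i).symm, inner_zernike_self ha, mul_zero, mul_one, zero_add]
  rw [tangent, h1, sinDeriv_dir k ha.ne', ← zernike_z00, neg_smul, add_neg_cancel_right]

theorem dPupil_eq_zernike (k : ℝ) {a : ℝ} (ha : a ≠ 0) (i : Fin 3) :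
    dPupil k a i = Complex.I • ((derivCoeff k a i : ℂ) • zernike a (derivMode i) +
      (derivPhase k a i : ℂ) • zernike a z00) := by
  rw [dPupil_eq, sinDeriv_dir k ha]

theorem pupil_zero_eq_zernike (k a : ℝ) : pupil k a 0 = zernike a z00 := by
  rw [pupil_zero, zernike_z00]

theorem isFlexible_of_inner {k a : ℝ} (ha : a ≠ 0) {v : Hilb}
    (h0 : inner ℂ (zernike a z00) v = 0) (h : ∀ i, inner ℂ (zernike a (derivMode i)) v = 0) :
    IsFlexible k a v := by
  refine ⟨by rw [pupil_zero_eq_zernike, h0], fun i => ?_⟩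
  rw [dPupil_eq_zernike k ha, inner_smul_left, inner_add_left, inner_smul_left, inner_smul_left,
    h0, h, mul_zero, mul_zero, add_zero, mul_zero]

theorem forall_derivMode {C : ZernikeIndex → Prop} :
    (∀ i, C (derivMode i)) ↔ C z11 ∧ C z1m1 ∧ C z20 := by
  refine ⟨fun h => ⟨h 0, h 1, h 2⟩, fun h i => ?_⟩
  fin_cases i
  exacts [h.1, h.2.1, h.2.2]

theorem isFlexible_zernike {k a : ℝ} (ha : 0 < a) {p : ZernikeIndex} (h0 : p ≠ z00)
    (h1 : p ≠ z11) (h2 : p ≠ z1m1) (h3 : p ≠ z20) : IsFlexible k a (zernike a p) :=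
  isFlexible_of_inner ha.ne' (inner_zernike_ne ha h0.symm)
    (forall_derivMode (C := fun q => inner ℂ (zernike a q) (zernike a p) = 0) |>.2
      ⟨inner_zernike_ne ha h1.symm, inner_zernike_ne ha h2.symm,
        inner_zernike_ne ha h3.symm⟩)

theorem inner_zernike_vanishing {a : ℝ} {f : Hilb} (hf : f ∈ vanishingOnPupil a)
    (p : ZernikeIndex) : inner ℂ (zernike a p) f = 0 := by
  rw [zernike_eq, inner_discVec_left]
  refine (setIntegral_congr_ae (g := fun _ => 0) measurableSet_closedBall ?_).trans
    (integral_zero _ _)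
  filter_upwards [show ∀ᵐ x : Plane, ‖x‖ ≤ a → f x = 0 from hf] with x hx hxa
  rw [hx (mem_closedBall_zero_iff.1 hxa), mul_zero]

theorem isFlexible_vanishing {k a : ℝ} (ha : a ≠ 0) {f : Hilb} (hf : f ∈ vanishingOnPupil a) :
    IsFlexible k a f :=
  isFlexible_of_inner ha (inner_zernike_vanishing hf _) fun _ => inner_zernike_vanishing hf _

/-- The modes spanning the range of the `m`-th projector. -/
def measurementModes (a : ℝ) : Fin 4 → Set Hilb :=
  Fin.cons ({f | ∃ p, p ≠ z11 ∧ p ≠ z1m1 ∧ p ≠ z20 ∧ f = zernike a p} ∪ vanishingOnPupil a)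
    fun i => {zernike a (derivMode i)}

theorem measurement_eq (a : ℝ) (m : Fin 4) : measurement a m = projOn (measurementModes a m) := by
  fin_cases m <;> rfl

theorem measurement_succ (a : ℝ) (i : Fin 3) :
    measurement a i.succ = projOn {zernike a (derivMode i)} := by
  rw [measurement_eq]
  rfl

theorem inner_derivMode_of_mem {a : ℝ} (ha : 0 < a) {f : Hilb} (hf : f ∈ measurementModes a 0)
    (i : Fin 3) : inner ℂ (zernike a (derivMode i)) f = 0 := by
  rcases hf with ⟨p, h1, h2, h3, rfl⟩ | hf
  · exact forall_derivMode (C := fun q => inner ℂ (zernike a q) (zernike a p) = 0) |>.2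
      ⟨inner_zernike_ne ha h1.symm, inner_zernike_ne ha h2.symm, inner_zernike_ne ha h3.symm⟩ i
  · exact inner_zernike_vanishing hf _

theorem inner_measurementModes {a : ℝ} (ha : 0 < a) (m m' : Fin 4) (h : m ≠ m') :
    ∀ f ∈ measurementModes a m, ∀ g ∈ measurementModes a m', inner ℂ f g = 0 := by
  intro f hf g hg
  rcases Fin.eq_zero_or_eq_succ m with rfl | ⟨i, rfl⟩ <;>
    rcases Fin.eq_zero_or_eq_succ m' with rfl | ⟨j, rfl⟩
  · exact absurd rfl h
  · obtain rfl : g = zernike a (derivMode j) := hg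
    exact inner_eq_zero_symm.1 (inner_derivMode_of_mem ha hf j)
  · obtain rfl : f = zernike a (derivMode i) := hf
    exact inner_derivMode_of_mem ha hg i
  · obtain rfl : f = zernike a (derivMode i) := hf
    obtain rfl : g = zernike a (derivMode j) := hg
    exact inner_zernike_ne ha fun h' => h (congrArg Fin.succ (derivMode_injective h'))

theorem sum_measurement {a : ℝ} (ha : 0 < a) : ∑ m, measurement a m = 1 := by
  simp only [measurement_eq]
  refine sum_projOn_eq_one (inner_measurementModes ha) fun v hv =>
    eq_zero_of_inner_zernike ha.ne' (fun p => ?_) fun f hf => hv 0 f (Or.inr hf)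
  by_cases hp : ∃ i : Fin 3, p = derivMode i
  · obtain ⟨i, rfl⟩ := hp
    exact hv i.succ _ rfl
  · push Not at hp
    exact hv 0 _ (Or.inl ⟨p, hp 0, hp 1, hp 2, rfl⟩)

theorem isStarProjection_measurement (a : ℝ) (m : Fin 4) : IsStarProjection (measurement a m) := by
  rw [measurement_eq]
  exact isStarProjection_projOn _

theorem regularAtZero_measurement (k : ℝ) {a : ℝ} (ha : 0 < a) :
    RegularAtZero k a (measurement a 0) := by
  have hmem : zernike a z00 ∈ measurementModes a 0 :=
    Or.inl ⟨z00, (derivMode_ne 0).symm, (derivMode_ne 1).symm, (derivMode_ne 2).symm, rfl⟩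
  rw [regularAtZero_iff (isStarProjection_measurement a 0), measurement_eq, ← zernike_z00,
    projOn_apply_of_mem hmem]
  exact (orthonormal_zernike ha).ne_zero z00

theorem nullAtZero_measurement (k : ℝ) {a : ℝ} (ha : 0 < a) (i : Fin 3) :
    NullAtZero k a (measurement a i.succ) := by
  rw [nullAtZero_iff (isStarProjection_measurement a _), measurement_succ,
    projOn_apply_eq_zero_iff, ← zernike_z00]
  rintro f rfl
  exact inner_zernike_ne ha (derivMode_ne i)

theorem measurement_zero_tangent (k : ℝ) {a : ℝ} (ha : 0 < a) (i : Fin 3) :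
    measurement a 0 (tangent k a i) = 0 := by
  rw [measurement_eq, projOn_apply_eq_zero_iff]
  intro f hf
  rw [tangent_eq k ha, inner_smul_right, inner_eq_zero_symm.1 (inner_derivMode_of_mem ha hf i),
    mul_zero]

theorem inner_derivMode_sinDeriv (k : ℝ) {a : ℝ} (ha : 0 < a) (i j : Fin 3) :
    inner ℂ (zernike a (derivMode i)) (sinDeriv k a 0 (dir j)) =
      if i = j then (derivCoeff k a i : ℂ) else 0 := by
  rw [sinDeriv_dir k ha.ne', inner_add_right, inner_smul_right, inner_smul_right,
    inner_zernike_ne ha (derivMode_ne i), mul_zero, add_zero]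
  split_ifs with h
  · rw [h, inner_zernike_self ha, mul_one]
  · rw [inner_zernike_ne ha fun h' => h (derivMode_injective h'), mul_zero]

section

variable {k a : ℝ} {L : Separation → Fin 3 → Op}

theorem saturatedRegular_measurement (hk : k ≠ 0) (ha : 0 < a) (hL : ∀ s i, IsSLD k a s i (L s i)) :
    SaturatedRegular k a L (measurement a 0) :=
  (saturatedRegular_iff hk ha hL (isStarProjection_measurement a 0)
    (regularAtZero_measurement k ha)).2 (measurement_zero_tangent k ha)

theorem measurement_succ_sinDeriv (ha : 0 < a) {i j : Fin 3} (h : i ≠ j) :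
    measurement a i.succ (sinDeriv k a 0 (dir j)) = 0 := by
  rw [measurement_succ, projOn_apply_eq_zero_iff]
  rintro f rfl
  rw [inner_derivMode_sinDeriv k ha, if_neg h]

/-- Each of the three null projectors sees one derivative only. -/
theorem saturatedNull_measurement (hk : k ≠ 0) (ha : 0 < a) (hL : ∀ s i, IsSLD k a s i (L s i))
    (i : Fin 3) : SaturatedNull k a L (measurement a i.succ) := by
  refine (saturatedNull_iff hk ha hL (isStarProjection_measurement a _)
    (nullAtZero_measurement k ha i)).2 fun j l => ?_
  by_cases hj : i = j
  · by_cases hl : i = l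
    · exact Or.inl ⟨1, by rw [← hj, ← hl, Complex.ofReal_one, one_smul]⟩
    · exact Or.inr ⟨0, by rw [measurement_succ_sinDeriv ha hl, Complex.ofReal_zero, zero_smul]⟩
  · exact Or.inl ⟨0, by rw [measurement_succ_sinDeriv ha hj, Complex.ofReal_zero, zero_smul]⟩

theorem derivCoeff_ne_zero (hk : k ≠ 0) (ha : a ≠ 0) (i : Fin 3) : derivCoeff k a i ≠ 0 := by
  have h3 : Real.sqrt 3 ≠ 0 := by positivity
  fin_cases i <;> simp [derivCoeff, hk, ha]

theorem nondegenerate_measurement (hk : k ≠ 0) (ha : 0 < a) {δ : Separation} {i : Fin 3}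
    (hδ : δ i ≠ 0) : Nondegenerate k a (measurement a i.succ) δ := by
  have hP := isStarProjection_measurement a i.succ
  rw [nondegenerate_iff hP ((nullAtZero_iff hP).1 (nullAtZero_measurement k ha i)),
    measurement_succ, Ne, projOn_apply_eq_zero_iff]
  intro h
  have h1 := h _ rfl
  rw [sinDeriv_eq_sum, inner_sum] at h1
  simp only [inner_smul_right, inner_derivMode_sinDeriv k ha] at h1
  rw [Finset.sum_eq_single i (fun j _ hj => by rw [if_neg hj.symm, mul_zero]) (by simp),
    if_pos rfl] at h1
  exact mul_ne_zero (Complex.ofReal_ne_zero.2 hδ)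
    (Complex.ofReal_ne_zero.2 (derivCoeff_ne_zero hk ha.ne' i)) h1

theorem limitFisher_one (k : ℝ) (ha : 0 < a) :
    limitFisher k a 1 =
      Matrix.diagonal ![k ^ 2 * a ^ 2, k ^ 2 * a ^ 2, k ^ 2 * a ^ 4 / 12] := by
  have h3 : Real.sqrt 3 ^ 2 = 3 := Real.sq_sqrt (by norm_num)
  have h30 : Real.sqrt 3 ≠ 0 := by positivity
  ext i j
  rw [limitFisher, Matrix.of_apply, one_apply_eq_self, tangent_eq k ha,
    tangent_eq k ha, inner_smul_left, inner_smul_right, Complex.conj_ofReal,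
    Complex.re_ofReal_mul, Complex.re_ofReal_mul]
  by_cases h : i = j
  · subst h
    rw [inner_zernike_self ha, Complex.one_re, mul_one, Matrix.diagonal_apply_eq]
    fin_cases i
    · simp [derivCoeff]
      ring
    · simp [derivCoeff]
      ring
    · simp [derivCoeff]
      field_simp
      rw [h3]
      ring
  · rw [inner_zernike_ne ha fun h' => h (derivMode_injective h'), Complex.zero_re, mul_zero,
      mul_zero, mul_zero, Matrix.diagonal_apply_ne _ h]

theorem limitFisher_sum (k a : ℝ) {ι : Type*} (s : Finset ι) (P : ι → Op) :
    ∑ m ∈ s, limitFisher k a (P m) = limitFisher k a (∑ m ∈ s, P m) := by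
  ext i j
  rw [Matrix.sum_apply]
  simp only [limitFisher, Matrix.of_apply, _root_.sum_apply, sum_inner, Complex.re_sum,
    Finset.mul_sum]

/-- Along a direction in which no coordinate vanishes each projector attains its own limit, and
these limits add up to the limit for `Π = 1`. -/
theorem tendsto_sum_cfim (hk : k ≠ 0) (ha : 0 < a) (hL : ∀ s i, IsSLD k a s i (L s i))
    {δ : Separation} (hδ : ∀ i, δ i ≠ 0) :
    Tendsto (fun s => ∑ m, cfim k a (measurement a m) s) (alongDir δ)
      (𝓝 (limitFisher k a 1)) := by
  rw [← sum_measurement ha, ← limitFisher_sum]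
  refine tendsto_finsetSum _ fun m _ => ?_
  rcases Fin.eq_zero_or_eq_succ m with rfl | ⟨i, rfl⟩
  -- the regular projector carries no information in the limit
  · rw [(limitFisher_eq_zero_iff (isStarProjection_measurement a 0)).2
      (measurement_zero_tangent k ha)]
    exact (tendsto_cfim_regular (isStarProjection_measurement a 0)
      (regularAtZero_measurement k ha)).mono_left (alongDir_le_nhds δ)
  · obtain ⟨J, hJ, hc⟩ := saturatedNull_measurement hk ha hL i
    rw [tendsto_nhds_unique
      (tendsto_qfim hk ha hL (isStarProjection_measurement a i.succ).isSelfAdjoint) hJ]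
    exact hc δ (Or.inl (nondegenerate_measurement hk ha (hδ i)))

end

end TwoSources

end

open TwoSources

theorem corollary1 (k a : ℝ) (hk : 0 < k) (ha : 0 < a) :
    -- symmetric logarithmic derivatives exist; they may be chosen at will
    (∀ s i, ∃ L, IsSLD k a s i L) ∧
    ∀ L : Separation → Fin 3 → Op, (∀ s i, IsSLD k a s i (L s i)) →
      -- regular projectors
      (∀ (ι : Type*) (v : ι → Hilb), Orthonormal ℂ v → RegularAtZero k a (projOn (Set.range v)) →
        (SaturatedRegular k a L (projOn (Set.range v)) ↔
          ∀ i α, inner ℂ (dPupilKer k a i) (v α) = 0)) ∧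
      -- null projectors
      (∀ (ι : Type*) (v : ι → Hilb), Orthonormal ℂ v → NullAtZero k a (projOn (Set.range v)) →
        (SaturatedNull k a L (projOn (Set.range v)) ↔
          ∀ i j,
            (∃ η : ℝ, ∀ α, inner ℂ (dPupil k a i) (v α) = (η : ℂ) * inner ℂ (dPupil k a j) (v α)) ∨
            (∃ η : ℝ, ∀ α, inner ℂ (dPupil k a j) (v α) =
              (η : ℂ) * inner ℂ (dPupil k a i) (v α)))) ∧
      -- the Zernike modes
      (Orthonormal ℂ (zernike a) ∧ zernike a z00 = pupil k a 0 ∧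
        (∀ p, p ≠ z00 → p ≠ z11 → p ≠ z1m1 → p ≠ z20 → IsFlexible k a (zernike a p)) ∧
        (∀ f ∈ vanishingOnPupil a, IsFlexible k a f)) ∧
      -- the four projectors form a projective measurement, and each saturates its matrix bound
      ((∑ m, measurement a m = 1) ∧
        (∀ m m', m ≠ m' → measurement a m * measurement a m' = 0) ∧
        (RegularAtZero k a (measurement a 0) ∧ SaturatedRegular k a L (measurement a 0)) ∧
        (∀ m, m ≠ 0 → NullAtZero k a (measurement a m) ∧ SaturatedNull k a L (measurement a m))) ∧
      -- the total classical and quantum Fisher information matrices agree in the limit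
      (Tendsto (qfim k a L 1) (𝓝[≠] 0)
          (𝓝 (Matrix.diagonal ![k ^ 2 * a ^ 2, k ^ 2 * a ^ 2, k ^ 2 * a ^ 4 / 12])) ∧
        ∀ δ : Separation, (∀ i, δ i ≠ 0) →
          Tendsto (fun s => ∑ m, cfim k a (measurement a m) s) (alongDir δ)
            (𝓝 (Matrix.diagonal ![k ^ 2 * a ^ 2, k ^ 2 * a ^ 2, k ^ 2 * a ^ 4 / 12]))) := by
  refine ⟨exists_isSLD hk.ne' ha, fun L hL => ⟨fun ι v _ h => ?_, fun ι v _ h => ?_,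
    ⟨orthonormal_zernike ha, (pupil_zero_eq_zernike k a).symm,
      fun p => isFlexible_zernike ha, fun f => isFlexible_vanishing ha.ne'⟩,
    ⟨sum_measurement ha, fun m m' h => ?_,
      ⟨regularAtZero_measurement k ha, saturatedRegular_measurement hk.ne' ha hL⟩, fun m hm => ?_⟩,
    ?_, fun δ hδ => ?_⟩⟩
  · rw [saturatedRegular_projOn_iff hk.ne' ha hL h]
    simp only [Set.forall_mem_range]
  · rw [saturatedNull_projOn_iff hk.ne' ha hL h]
    simp only [Set.forall_mem_range]
  · rw [measurement_eq, measurement_eq]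
    exact projOn_mul_projOn_eq_zero (inner_measurementModes ha m m' h)
  · obtain ⟨i, rfl⟩ := Fin.eq_succ_of_ne_zero hm
    exact ⟨nullAtZero_measurement k ha i, saturatedNull_measurement hk.ne' ha hL i⟩
  · rw [← limitFisher_one k ha]
    exact tendsto_qfim hk.ne' ha hL (IsSelfAdjoint.one _)
  · rw [← limitFisher_one k ha]
    exact tendsto_sum_cfim hk.ne' ha hL hδ
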